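/- Let $0<q<1$, $\alpha\in\mathbb R\setminus\{0\}$ and $\beta\ge 0$. Let $\{e_l\}_{l\in\mathbb Z}$ be the standard orthonormal basis of the complex Hilbert space $\ell^2(\mathbb Z)$ and let $L=L(\alpha,\beta)$ be the bounded operator on $\ell^2(\mathbb Z)$ with $$L e_l=a_l e_{l+1}+b_l e_l+a_{l-1}e_{l-1},\qquad l\in\mathbb Z,$$ where $$a_l=\frac{\alpha q^{l+1/2}}{1+\alpha^2q^{2l+1}}\sqrt{\frac{(\beta+\alpha^2q^{2l})(1+\beta\alpha^2q^{2l+2})}{(1+\alpha^2q^{2l})(1+\alpha^2q^{2l+2})}},$$ $$b_l=1-\frac{1+\beta\alpha^2q^{2l}}{(1+\alpha^2q^{2l})(1+\alpha^2q^{2l-1})}-\frac{1+\beta\alpha^{-2}q^{-2l}}{(1+\alpha^{-2}q^{-2l})(1+\alpha^{-2}q^{-2l-1})}.$$ Let $h_n^{(\beta)}(x|q)$ be the symmetric Al-Salam–Chihara polynomials, determined by $h_0^{(\beta)}=1$, $h_1^{(\beta)}=2x$ and $$2x\,h_n^{(\beta)}(x|q)=h_{n+1}^{(\beta)}(x|q)+q^{-n}(1-q^n)(1+\beta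 q^{1-n})\,h_{n-1}^{(\beta)}(x|q),\qquad n\ge 1,$$ and let $x_l(\alpha)=\frac12\bigl(\frac1{\alpha q^l}-\alpha q^l\bigr)$ for $l\in\mathbb Z$. Put $$w_l=\alpha^l q^{l^2/2}\sqrt{1+\alpha^2q^{2l}}\;\sqrt{\pi_l},\qquad \pi_0=1,\quad \frac{\pi_{l+1}}{\pi_l}=\frac{\beta+\alpha^2q^{2l}}{1+\beta\alpha^2q^{2l+2}}\quad(l\in\mathbb Z).$$ Then: 1. $L$ is self-adjoint and its spectrum is $\sigma(L)=\{-\beta q^n: n\ge 1\}\cup\{0\}\cup\{q^n: n\ge 0\}$. 2. $0$ is an accumulation point of $\sigma(L)$ and is not an eigenvalue of $L$. 3. For every $n\ge 0$, $q^n$ is a simple eigenvalue of $L$: the sequence $\bigl(w_l\,h_n^{(\beta)}(x_l(\alpha)|q)\bigr)_{l\in\mathbb Z}$ is a nonzero element of $\ell^2(\mathbb Z)$ and spans the eigenspace $\ker(L-q^n)$. -/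

import Mathlib

open scoped ENNReal

noncomputable section

namespace SymASC

/-- The complex Hilbert space `ℓ²(ℤ)`. -/
abbrev L2Z : Type := lp (fun _ : ℤ => ℂ) 2

/-- The standard orthonormal basis vector `e_l` of `ℓ²(ℤ)`. -/
def e (l : ℤ) : L2Z := lp.single 2 l (1 : ℂ)

/-- The off-diagonal coefficient `a_l(α, β)` in base `q`. -/
def a (q α β : ℝ) (l : ℤ) : ℝ :=
  α * q ^ ((l : ℝ) + 1 / 2) / (1 + α ^ 2 * q ^ (2 * l + 1)) *
    √((β + α ^ 2 * q ^ (2 * l)) * (1 + β * α ^ 2 * q ^ (2 * l + 2)) /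
      ((1 + α ^ 2 * q ^ (2 * l)) * (1 + α ^ 2 * q ^ (2 * l + 2))))

/-- The diagonal coefficient `b_l(α, β)` in base `q`. -/
def b (q α β : ℝ) (l : ℤ) : ℝ :=
  1 - (1 + β * α ^ 2 * q ^ (2 * l)) /
        ((1 + α ^ 2 * q ^ (2 * l)) * (1 + α ^ 2 * q ^ (2 * l - 1)))
    - (1 + β * α ^ (-2 : ℤ) * q ^ (-2 * l)) /
        ((1 + α ^ (-2 : ℤ) * q ^ (-2 * l)) * (1 + α ^ (-2 : ℤ) * q ^ (-2 * l - 1)))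

theorem one_add_mul_div_le {β x : ℝ} (hβ : 0 ≤ β) (hx : 0 ≤ x) :
    (1 + β * x) / (1 + x) ≤ 1 + β := by
  rw [div_le_iff₀ (by positivity)]
  nlinarith [mul_nonneg hβ hx]

theorem add_div_le {β x : ℝ} (hβ : 0 ≤ β) (hx : 0 ≤ x) :
    (β + x) / (1 + x) ≤ 1 + β := by
  rw [div_le_iff₀ (by positivity)]
  nlinarith [mul_nonneg hβ hx]

theorem abs_a_le {q β : ℝ} (hq : 0 < q) (α : ℝ) (hβ : 0 ≤ β) (l : ℤ) :
    |a q α β l| ≤ 1 + β := by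
  have hX : 0 ≤ α ^ 2 * q ^ (2 * l) := by positivity
  have hY : 0 ≤ α ^ 2 * q ^ (2 * l + 2) := by positivity
  unfold a
  rw [abs_mul, abs_of_nonneg (Real.sqrt_nonneg _)]
  have h1 : |α * q ^ ((l : ℝ) + 1 / 2) / (1 + α ^ 2 * q ^ (2 * l + 1))| ≤ 1 := by
    have hs : (α * q ^ ((l : ℝ) + 1 / 2)) ^ 2 = α ^ 2 * q ^ (2 * l + 1) := by
      rw [mul_pow, ← Real.rpow_natCast (q ^ _), ← Real.rpow_mul hq.le, ← Real.rpow_intCast]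
      congr 2
      push_cast
      ring
    rw [← hs, abs_div, abs_of_pos (a := 1 + _) (by positivity), div_le_one (by positivity),
      ← sq_abs]
    nlinarith [sq_nonneg (|α * q ^ ((l : ℝ) + 1 / 2)| - 1 / 2)]
  have h2 : √((β + α ^ 2 * q ^ (2 * l)) * (1 + β * α ^ 2 * q ^ (2 * l + 2)) /
      ((1 + α ^ 2 * q ^ (2 * l)) * (1 + α ^ 2 * q ^ (2 * l + 2)))) ≤ 1 + β := by
    apply Real.sqrt_le_iff.2 ⟨by positivity, ?_⟩
    rw [mul_div_mul_comm, sq (1 + β), mul_assoc β]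
    exact mul_le_mul (add_div_le hβ hX) (one_add_mul_div_le hβ hY) (by positivity) (by positivity)
  calc _ ≤ 1 * (1 + β) := mul_le_mul h1 h2 (Real.sqrt_nonneg _) zero_le_one
    _ = 1 + β := one_mul _

theorem abs_b_le {q β : ℝ} (hq : 0 < q) (α : ℝ) (hβ : 0 ≤ β) (l : ℤ) :
    |b q α β l| ≤ 1 + (1 + β) + (1 + β) := by
  have key : ∀ x y : ℝ, 0 ≤ x → 0 ≤ y →
      |(1 + β * x) / ((1 + x) * (1 + y))| ≤ 1 + β := by
    intro x y hx hy
    rw [abs_of_nonneg (by positivity), ← div_div]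
    exact (div_le_self (by positivity) (by linarith)).trans (one_add_mul_div_le hβ hx)
  have hα : 0 ≤ α ^ (-2 : ℤ) := (even_neg.2 even_two).zpow_nonneg α
  unfold b
  rw [mul_assoc β, mul_assoc β]
  refine (abs_sub _ _).trans (add_le_add ((abs_sub _ _).trans (add_le_add (by simp) ?_)) ?_)
  · exact key _ _ (by positivity) (by positivity)
  · exact key _ _ (by positivity) (by positivity)

theorem summable_weightedShift (c : ℤ → ℝ) (C : ℝ) (hc : ∀ l, |c l| ≤ C) (s : ℤ) (f : L2Z) :
    (Summable fun l : ℤ => ‖(c l : ℂ) * f (l + s)‖ ^ (2 : ℝ≥0∞).toReal) ∧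
      ∑' l : ℤ, ‖(c l : ℂ) * f (l + s)‖ ^ (2 : ℝ≥0∞).toReal ≤
        (C * ‖f‖) ^ (2 : ℝ≥0∞).toReal := by
  have h2 : 0 < (2 : ℝ≥0∞).toReal := by simp
  have hC : 0 ≤ C := (abs_nonneg _).trans (hc 0)
  have hf : Summable fun l : ℤ => ‖f l‖ ^ (2 : ℝ≥0∞).toReal := (lp.memℓp f).summable h2
  have hfs : Summable fun l : ℤ => ‖f (l + s)‖ ^ (2 : ℝ≥0∞).toReal :=
    (Equiv.addRight s).summable_iff.2 hf
  have hle : ∀ l : ℤ, ‖(c l : ℂ) * f (l + s)‖ ^ (2 : ℝ≥0∞).toReal ≤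
      C ^ (2 : ℝ≥0∞).toReal * ‖f (l + s)‖ ^ (2 : ℝ≥0∞).toReal := by
    intro l
    rw [← Real.mul_rpow hC (norm_nonneg _), norm_mul, Complex.norm_real, Real.norm_eq_abs]
    exact Real.rpow_le_rpow (by positivity)
      (mul_le_mul_of_nonneg_right (hc l) (norm_nonneg _)) h2.le
  have hsum := Summable.of_nonneg_of_le (fun l => by positivity) hle (hfs.mul_left _)
  refine ⟨hsum, ?_⟩
  refine (hsum.tsum_le_tsum hle (hfs.mul_left _)).trans (le_of_eq ?_)
  rw [tsum_mul_left, Real.mul_rpow hC (norm_nonneg _), lp.norm_rpow_eq_tsum h2]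
  congr 1
  exact (Equiv.addRight s).tsum_eq fun l : ℤ => ‖f l‖ ^ (2 : ℝ≥0∞).toReal

/-- For a bounded real sequence `c`, the bounded operator `(T f)_l = c_l f_{l+s}` on `ℓ²(ℤ)`. -/
def weightedShift (c : ℤ → ℝ) (C : ℝ) (hc : ∀ l, |c l| ≤ C) (s : ℤ) : L2Z →L[ℂ] L2Z :=
  LinearMap.mkContinuous
    { toFun := fun f =>
        ⟨fun l => (c l : ℂ) * f (l + s), memℓp_gen (summable_weightedShift c C hc s f).1⟩
      map_add' := fun f g => by
        ext l
        change (c l : ℂ) * (f (l + s) + g (l + s)) = c l * f (l + s) + c l * g (l + s)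
        ring
      map_smul' := fun z f => by
        ext l
        change (c l : ℂ) * (z * f (l + s)) = z * (c l * f (l + s))
        ring }
    C fun f => lp.norm_le_of_tsum_le (by simp)
      (mul_nonneg ((abs_nonneg _).trans (hc 0)) (norm_nonneg _))
      (summable_weightedShift c C hc s f).2

/-- The bounded operator `L(α, β)` on `ℓ²(ℤ)`,
`(L f)_l = a_l f_{l+1} + b_l f_l + a_{l-1} f_{l-1}`. -/
def L {q : ℝ} (hq : 0 < q) (α : ℝ) {β : ℝ} (hβ : 0 ≤ β) : L2Z →L[ℂ] L2Z :=
  weightedShift (a q α β) _ (abs_a_le hq α hβ) 1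
    + weightedShift (b q α β) _ (abs_b_le hq α hβ) 0
    + weightedShift (fun l => a q α β (l - 1)) _ (fun l => abs_a_le hq α hβ (l - 1)) (-1)

theorem L_apply {q : ℝ} (hq : 0 < q) (α : ℝ) {β : ℝ} (hβ : 0 ≤ β) (f : L2Z) (l : ℤ) :
    L hq α hβ f l =
      a q α β l * f (l + 1) + b q α β l * f l + a q α β (l - 1) * f (l - 1) := by
  change (a q α β l : ℂ) * f (l + 1) + b q α β l * f (l + 0) + a q α β (l - 1) * f (l + -1) = _
  rw [add_zero, ← sub_eq_add_neg]

theorem L_e {q : ℝ} (hq : 0 < q) (α : ℝ) {β : ℝ} (hβ : 0 ≤ β) (l : ℤ) :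
    L hq α hβ (e l) =
      (a q α β l : ℂ) • e (l + 1) + (b q α β l : ℂ) • e l
        + (a q α β (l - 1) : ℂ) • e (l - 1) := by
  have he : ∀ i j : ℤ, e i j = if j = i then 1 else 0 := by
    intro i j
    simp [e, lp.single_apply, Pi.single_apply]
  ext k
  rw [L_apply]
  change _ = (a q α β l : ℂ) * e (l + 1) k + (b q α β l : ℂ) * e l k
        + (a q α β (l - 1) : ℂ) * e (l - 1) k
  simp only [he]
  rcases eq_or_ne k l with rfl | h1
  · simp [show k ≠ k - 1 by lia]
  rcases eq_or_ne k (l + 1) with rfl | h2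
  · simp [show l + 1 + 1 ≠ l by lia, show l + 1 ≠ l - 1 by lia]
  rcases eq_or_ne k (l - 1) with rfl | h3
  · simp [show l - 1 - 1 ≠ l by lia, show l - 1 ≠ l + 1 by lia]
  · simp [h1, h2, h3, show k + 1 ≠ l by lia, show k - 1 ≠ l by lia]

/-- The symmetric Al-Salam–Chihara polynomials `h_n^{(β)}(x | q)`: `h_0 = 1`, `h_1 = 2x`,
`h_{n+1} = 2x h_n - q^{-n} (1 - q^n) (1 + β q^{1-n}) h_{n-1}`. -/
def h (q β : ℝ) : ℕ → Polynomial ℝ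
  | 0 => 1
  | 1 => 2 * Polynomial.X
  | n + 2 => 2 * Polynomial.X * h q β (n + 1)
      - Polynomial.C ((q ^ (n + 1))⁻¹ * (1 - q ^ (n + 1)) * (1 + β * (q ^ n)⁻¹)) * h q β n

/-- The grid point `x_k(α)`. -/
def gridPoint (q α : ℝ) (k : ℤ) : ℝ := (1 / (α * q ^ k) - α * q ^ k) / 2

/-- The product `∏_{0 ≤ k < l} u_k` for `l ≥ 0`, and `∏_{l ≤ k < 0} u_k⁻¹` for `l < 0`. -/
def zprod (u : ℤ → ℝ) (l : ℤ) : ℝ :=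
  (∏ k ∈ Finset.Ico 0 l, u k) * ∏ k ∈ Finset.Ico l 0, (u k)⁻¹

/-- The factor `h_l` (normalized up to a positive constant) in `δ_l = h_l e_l` by which the point
mass `δ_l` at `x_l(α)` is rescaled. It is
`α^l β^{l/2} q^{l²/2} √(1 + α² q^{2l}) √((-α²/β; q²)_l / (-α² β q²; q²)_l)`, with the powers of
`β` multiplied into the shifted factorial so that it also makes sense for `β = 0`. -/
def weight (q α β : ℝ) (l : ℤ) : ℝ :=
  α ^ l * q ^ ((l : ℝ) ^ 2 / 2) * √(1 + α ^ 2 * q ^ (2 * l)) *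
    √(zprod (fun k => (β + α ^ 2 * q ^ (2 * k)) / (1 + β * α ^ 2 * q ^ (2 * k + 2))) l)

end SymASC

end

/-!
The eigenvalue equation of `L` is explicitly solvable, and the eigenvectors found in this way are
shown to be complete by comparing the sum of the squares of their eigenvalues with the
Hilbert–Schmidt norm of `L`.

*Eigenvectors.* Write `z = α q^l`, `X = z²` and `f_l = w_l p(x_l)`. In terms of `p`, regarded as a
function of `z`, the operator `L` becomes the `q`-difference operator
`B(X) (p(qz) - p(z)) + A(X) (p(z/q) - p(z)) + p(z)` (`a_mul_weightRatio`, `a_eq_coefA_mul`,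
`b_eq`). The polynomials `h_n` satisfy a relation of first order in `z`, which gives `h_n(qz)` in
terms of `h_n(z)` and `h_{n-1}(z)` and follows by induction from the three-term recurrence
(`structure_relation`). The same relation at `-1/z` gives `h_n(z/q)`, and the sum of the two is the
eigenvalue equation with eigenvalue `q^n` (`difference_equation`). The weight decays
super-exponentially in both directions, so the eigenvectors are in `ℓ²(ℤ)`
(`summable_eigSeq_sq`). For `β > 0` the operator `L(α, β)` is conjugate to
`-β q L(α, 1/(β q²))` under `e_l ↦ (-1)^l e_l`, so the numbers `-β q^{n+1}` are eigenvalues too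
(`L_negEigVec`).

*Completeness.* The squared norms `‖L e_l‖²` form a telescoping series, with sum
`(1 + β² q²)/(1 - q²)` (`norm_sq_L_e_eq_sub`, `sum_norm_sq_L_le`). This is also the sum of the
squares of the eigenvalues found, so by Bessel's inequality `L` vanishes on the orthogonal
complement of the eigenvectors (`apply_eq_zero_of_orthogonal_eigenvectors`). Since `L` is injective
(`eq_zero_of_L_eq_zero`), the eigenvectors form an orthogonal basis, and the spectrum is the closure
of the set of eigenvalues (`spectrum_eq_closure_of_hasSum_sq`).

*Injectivity.* For `β > 0` one has `a_{l+1}/a_l → q` and `b_{l+1}/a_l → 0` as `l → ∞`, so a nonzero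
solution of `L f = 0` cannot be bounded. For `β = 0` this estimate fails, but then
`L = T* C T` with `C` diagonal and `T` bidiagonal (`L_factor_of_zero`), which reduces `L f = 0` to
two geometric recurrences without bounded solutions.

*Simplicity.* The Casorati determinant of two eigenvectors for the same eigenvalue is constant, and
it tends to zero (`exists_eq_smul_of_eigenvector`).
-/

/-! ### Hilbert–Schmidt operators with square-summable eigenvalues -/

section Abstract

variable {H : Type*} [NormedAddCommGroup H] [InnerProductSpace ℂ H]

/-- Parseval's identity. -/
theorem HilbertBasis.hasSum_norm_inner_sq {ι : Type*} (w : HilbertBasis ι ℂ H) (x : H) :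
    HasSum (fun i => ‖inner ℂ (w i) x‖ ^ 2) (‖x‖ ^ 2) := by
  have h1 := w.hasSum_inner_mul_inner x x
  have h2 : ∀ i, inner ℂ x (w i) * inner ℂ (w i) x = ((‖inner ℂ (w i) x‖ ^ 2 : ℝ) : ℂ) := by
    intro i
    rw [← inner_conj_symm x (w i), mul_comm, Complex.mul_conj, Complex.normSq_eq_norm_sq]
  have h3 : inner ℂ x x = ((‖x‖ ^ 2 : ℝ) : ℂ) := by
    rw [inner_self_eq_norm_sq_to_K]; norm_cast
  simp only [h2, h3] at h1
  exact Complex.hasSum_ofReal.1 h1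

variable [CompleteSpace H]

/-- The sum of `‖T w_i‖²` over an orthonormal family is at most the squared Hilbert–Schmidt norm. -/
theorem Orthonormal.sum_norm_sq_apply_le {T : H →L[ℂ] H} (hT : IsSelfAdjoint T) {κ : Type*}
    (e : HilbertBasis κ ℂ H) {S : ℝ} (hS : ∀ t : Finset κ, ∑ k ∈ t, ‖T (e k)‖ ^ 2 ≤ S)
    {ι : Type*} {w : ι → H} (hw : Orthonormal ℂ w) (s : Finset ι) :
    ∑ i ∈ s, ‖T (w i)‖ ^ 2 ≤ S := by
  have hsum : ∀ i, HasSum (fun k => ‖inner ℂ (w i) (T (e k))‖ ^ 2) (‖T (w i)‖ ^ 2) := by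
    intro i
    have h1 := e.hasSum_norm_inner_sq (T (w i))
    have h2 : ∀ k, ‖inner ℂ (e k) (T (w i))‖ = ‖inner ℂ (w i) (T (e k))‖ := by
      intro k
      have hsym : inner ℂ (T (w i)) (e k) = inner ℂ (w i) (T (e k)) :=
        hT.isSymmetric (w i) (e k)
      rw [← hsym, norm_inner_symm]
    simpa only [h2] using h1
  refine hasSum_le_of_sum_le (hasSum_sum fun i _ => hsum i) fun t => ?_
  refine le_trans (Finset.sum_le_sum fun k _ => ?_) (hS t)
  exact hw.sum_inner_products_le _

/-- If the squares of the eigenvalues of an orthonormal family of eigenvectors add up to (at least)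
the squared Hilbert–Schmidt norm, then the operator vanishes on the orthogonal complement. -/
theorem apply_eq_zero_of_orthogonal_eigenvectors {T : H →L[ℂ] H} (hT : IsSelfAdjoint T)
    {κ : Type*} (e : HilbertBasis κ ℂ H) {S : ℝ}
    (hS : ∀ t : Finset κ, ∑ k ∈ t, ‖T (e k)‖ ^ 2 ≤ S)
    {ι : Type*} {w : ι → H} (hw : Orthonormal ℂ w) {μ : ι → ℝ}
    (hμ : ∀ i, T (w i) = (μ i : ℂ) • w i) (hμS : HasSum (fun i => μ i ^ 2) S)
    {f : H} (hf : ∀ i, inner ℂ (w i) f = 0) : T f = 0 := by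
  classical
  by_cases hf0 : f = 0
  · simp [hf0]
  have hn : ‖f‖ ≠ 0 := by simpa using hf0
  let g : H := ((‖f‖⁻¹ : ℝ) : ℂ) • f
  have hg : ‖g‖ = 1 := by simp [g, norm_smul, hn]
  have hw' : Orthonormal ℂ (fun o : Option ι => o.elim g w) := by
    refine ⟨?_, ?_⟩
    · rintro (_ | i)
      · exact hg
      · exact hw.1 i
    · rintro (_ | i) (_ | j) hij
      · exact absurd rfl hij
      · simp only [Option.elim, g, inner_smul_left]
        rw [← inner_conj_symm, hf j]; simp
      · simp only [Option.elim, g, inner_smul_right, hf i, mul_zero]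
      · exact hw.2 (fun h => hij (by rw [h]))
  have key : ∀ s : Finset ι, ∑ i ∈ s, μ i ^ 2 ≤ S - ‖T g‖ ^ 2 := by
    intro s
    have := hw'.sum_norm_sq_apply_le hT e hS (Finset.insertNone s)
    rw [Finset.sum_insertNone] at this
    simp only [Option.elim, hμ, norm_smul, hw.1, mul_one, Complex.norm_real, Real.norm_eq_abs,
      sq_abs] at this
    linarith
  have h0 : S ≤ S - ‖T g‖ ^ 2 := hasSum_le_of_sum_le hμS key
  have h1 : T g = 0 := by
    rw [← norm_eq_zero]
    nlinarith [norm_nonneg (T g)]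
  have h2 : ((‖f‖⁻¹ : ℝ) : ℂ) • T f = 0 := by rw [← map_smul]; exact h1
  exact (smul_eq_zero.1 h2).resolve_left (by simpa using hf0)

/-- A number at positive distance from the eigenvalues of a Hilbert basis of eigenvectors of a
self-adjoint operator is not in the spectrum. -/
theorem notMem_spectrum_of_hilbertBasis {T : H →L[ℂ] H} (hT : IsSelfAdjoint T)
    {ι : Type*} (w : HilbertBasis ι ℂ H) {μ : ι → ℝ} (hμ : ∀ i, T (w i) = (μ i : ℂ) • w i)
    {z : ℂ} {d : ℝ} (hd : 0 < d) (hz : ∀ i, d ≤ ‖(μ i : ℂ) - z‖) : z ∉ spectrum ℂ T := by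
  -- in the basis `w`, `T - y` multiplies the `i`-th coordinate by `μ i - y`
  have hbelow : ∀ (y : ℂ), (∀ i, d ≤ ‖(μ i : ℂ) - y‖) → ∀ x : H, d * ‖x‖ ≤ ‖T x - y • x‖ := by
    intro y hy x
    have hcoord : ∀ i, inner ℂ (w i) (T x - y • x) = ((μ i : ℂ) - y) * inner ℂ (w i) x := by
      intro i
      have hsym : inner ℂ (T (w i)) x = inner ℂ (w i) (T x) := hT.isSymmetric (w i) x
      rw [inner_sub_right, ← hsym, hμ, inner_smul_left, inner_smul_right, Complex.conj_ofReal]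
      ring
    have hle : d ^ 2 * ‖x‖ ^ 2 ≤ ‖T x - y • x‖ ^ 2 := by
      refine hasSum_le (fun i => ?_) ((w.hasSum_norm_inner_sq x).mul_left (d ^ 2))
        (w.hasSum_norm_inner_sq (T x - y • x))
      rw [hcoord, norm_mul, mul_pow]
      gcongr
      exact hy i
    rw [← mul_pow] at hle
    exact le_of_sq_le_sq hle (norm_nonneg _)
  have hunit : IsUnit (T - z • (1 : H →L[ℂ] H)) := by
    rw [ContinuousLinearMap.isUnit_iff_bijective,
      ContinuousLinearMap.bijective_iff_dense_range_and_antilipschitz]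
    refine ⟨?_, ⟨⟨d⁻¹, by positivity⟩, ?_⟩⟩
    · rw [Submodule.topologicalClosure_eq_top_iff, ContinuousLinearMap.orthogonal_range,
        Submodule.eq_bot_iff]
      intro x hx
      have hadj : ContinuousLinearMap.adjoint (T - z • (1 : H →L[ℂ] H)) x
          = T x - (starRingEnd ℂ z) • x := by
        rw [← ContinuousLinearMap.star_eq_adjoint, star_sub, star_smul, star_one, hT.star_eq]
        simp
      have hx' : T x - (starRingEnd ℂ z) • x = 0 := by rw [← hadj]; exact hx
      have := hbelow (starRingEnd ℂ z) (fun i => by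
        have : (μ i : ℂ) - starRingEnd ℂ z = starRingEnd ℂ ((μ i : ℂ) - z) := by simp
        rw [this, RCLike.norm_conj]
        exact hz i) x
      rw [hx', norm_zero] at this
      have h0 : ‖x‖ ≤ 0 := by
        by_contra hcon
        push Not at hcon
        nlinarith
      simpa using h0
    · refine ContinuousLinearMap.antilipschitz_of_bound _ fun x => ?_
      have := hbelow z hz x
      change ‖x‖ ≤ d⁻¹ * ‖T x - z • x‖
      rw [inv_mul_eq_div, le_div_iff₀ hd]
      linarith
  rw [spectrum.notMem_iff, Algebra.algebraMap_eq_smul_one, ← IsUnit.neg_iff, neg_sub]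
  exact hunit

/-- An injective self-adjoint operator with distinct real eigenvalues `μ i` whose squares add up to
the squared Hilbert–Schmidt norm has no other spectrum than the closure of the set of the `μ i`. -/
theorem spectrum_eq_closure_of_hasSum_sq {T : H →L[ℂ] H} (hT : IsSelfAdjoint T)
    (hker : ∀ f, T f = 0 → f = 0) {κ : Type*} (e : HilbertBasis κ ℂ H) {S : ℝ}
    (hS : ∀ t : Finset κ, ∑ k ∈ t, ‖T (e k)‖ ^ 2 ≤ S)
    {ι : Type*} {v : ι → H} (hv : ∀ i, v i ≠ 0) {μ : ι → ℝ} (hinj : Function.Injective μ)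
    (hμ : ∀ i, T (v i) = (μ i : ℂ) • v i) (hμS : HasSum (fun i => μ i ^ 2) S) :
    spectrum ℂ T = closure (Set.range fun i => (μ i : ℂ)) := by
  have hvn : ∀ i, (‖v i‖ : ℂ) ≠ 0 := fun i => by simpa using hv i
  let w : ι → H := fun i => ((‖v i‖ : ℂ)⁻¹) • v i
  have hwμ : ∀ i, T (w i) = (μ i : ℂ) • w i := by
    intro i
    simp only [w, map_smul, hμ]
    rw [smul_comm]
  have hw : Orthonormal ℂ w := by
    refine ⟨fun i => ?_, fun i j hij => ?_⟩
    · simp [w, norm_smul, hv i]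
    · have hsym : inner ℂ (T (w i)) (w j) = inner ℂ (w i) (T (w j)) := hT.isSymmetric _ _
      rw [hwμ i, hwμ j, inner_smul_left, inner_smul_right (w i) (w j),
        Complex.conj_ofReal] at hsym
      have hne : (μ i : ℂ) - μ j ≠ 0 := by
        rw [sub_ne_zero]
        exact_mod_cast fun h => hij (hinj h)
      have : ((μ i : ℂ) - μ j) * inner ℂ (w i) (w j) = 0 := by rw [sub_mul, hsym, sub_self]
      exact (mul_eq_zero.1 this).resolve_left hne
  have hbot : (Submodule.span ℂ (Set.range w))ᗮ = ⊥ := by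
    rw [Submodule.eq_bot_iff]
    intro f hf
    refine hker f (apply_eq_zero_of_orthogonal_eigenvectors hT e hS hw hwμ hμS fun i => ?_)
    exact (Submodule.mem_orthogonal _ _).1 hf _ (Submodule.subset_span ⟨i, rfl⟩)
  let W : HilbertBasis ι ℂ H := HilbertBasis.mkOfOrthogonalEqBot hw hbot
  have hW : ∀ i, W i = w i := fun i => by simp [W]
  apply Set.Subset.antisymm
  · intro z hz
    by_contra hcl
    rw [Metric.mem_closure_iff] at hcl
    push Not at hcl
    obtain ⟨d, hd, hz'⟩ := hcl
    refine notMem_spectrum_of_hilbertBasis (μ := μ) hT W (fun i => ?_) hd (fun i => ?_) hz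
    · rw [hW, hwμ]
    · have := hz' _ ⟨i, rfl⟩
      rwa [dist_comm, dist_eq_norm] at this
  · refine closure_minimal ?_ (spectrum.isClosed T)
    rintro _ ⟨i, rfl⟩
    rw [spectrum.mem_iff]
    intro hu
    have hinj' := (ContinuousLinearMap.isUnit_iff_bijective.1 hu).1
    refine hv i (hinj' ?_)
    rw [map_zero]
    simp [Algebra.algebraMap_eq_smul_one, hμ]

end Abstract

noncomputable section

namespace SymASC

open Filter Topology

variable {q α β : ℝ}

/-! ### The coefficients as functions of `X = α² q^{2l}` -/

/-- The square `α² q^{2l}` of the parameter `α q^l` of the grid point `x_l(α)`. -/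
def gridSq (q α : ℝ) (l : ℤ) : ℝ := α ^ 2 * q ^ (2 * l)

/-- The coefficient of `p(z / q)` in the `q`-difference operator diagonalised by the `h_n`, as a
function of `X = z²`. -/
def coefA (q β X : ℝ) : ℝ := (1 + β * X) / ((1 + X) * (1 + X / q))

/-- The coefficient of `p(q z)` in the `q`-difference operator diagonalised by the `h_n`, as a
function of `X = z²`. -/
def coefB (q β X : ℝ) : ℝ := q * X * (β + X) / ((1 + X) * (1 + q * X))

/-- The square root `α q^{l + 1/2}` of `q X`, with the sign of `α`. -/
def gridRoot (q α : ℝ) (l : ℤ) : ℝ := α * q ^ ((l : ℝ) + 1 / 2)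

theorem gridSq_pos (hq : 0 < q) (hα : α ≠ 0) (l : ℤ) : 0 < gridSq q α l := by
  unfold gridSq; positivity

theorem gridSq_succ (hq : 0 < q) (l : ℤ) : gridSq q α (l + 1) = q ^ 2 * gridSq q α l := by
  unfold gridSq
  rw [show 2 * (l + 1) = 2 * l + 2 by ring, zpow_add₀ hq.ne']
  norm_cast
  ring

theorem gridRoot_sq (hq : 0 < q) (l : ℤ) : gridRoot q α l ^ 2 = q * gridSq q α l := by
  unfold gridRoot gridSq
  rw [mul_pow, ← Real.rpow_natCast (q ^ _), ← Real.rpow_mul hq.le, ← Real.rpow_intCast]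
  rw [show ((l : ℝ) + 1 / 2) * ((2 : ℕ) : ℝ) = ((2 * l : ℤ) : ℝ) + 1 by push_cast; ring,
    Real.rpow_add hq, Real.rpow_one]
  ring

theorem gridRoot_succ (hq : 0 < q) (l : ℤ) : gridRoot q α (l + 1) = q * gridRoot q α l := by
  unfold gridRoot
  rw [show (((l + 1 : ℤ) : ℝ) + 1 / 2) = ((l : ℝ) + 1 / 2) + 1 by push_cast; ring,
    Real.rpow_add hq, Real.rpow_one]
  ring

theorem gridRoot_ne_zero (hq : 0 < q) (hα : α ≠ 0) (l : ℤ) : gridRoot q α l ≠ 0 :=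
  mul_ne_zero hα (Real.rpow_pos_of_pos hq _).ne'

theorem a_eq (hq : 0 < q) (l : ℤ) :
    a q α β l = gridRoot q α l / (1 + q * gridSq q α l) *
      √((β + gridSq q α l) * (1 + β * (q ^ 2 * gridSq q α l)) /
        ((1 + gridSq q α l) * (1 + q ^ 2 * gridSq q α l))) := by
  have h1 : α ^ 2 * q ^ (2 * l + 1) = q * gridSq q α l := by
    unfold gridSq; rw [zpow_add₀ hq.ne', zpow_one]; ring
  have h2 : α ^ 2 * q ^ (2 * l + 2) = q ^ 2 * gridSq q α l := by
    unfold gridSq; rw [zpow_add₀ hq.ne']; norm_cast; ring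
  unfold a
  rw [mul_assoc β, h1, h2]
  rfl

theorem a_ne_zero (hq : 0 < q) (hα : α ≠ 0) (hβ : 0 ≤ β) (l : ℤ) : a q α β l ≠ 0 := by
  have hX := gridSq_pos hq hα l
  rw [a_eq hq]
  refine mul_ne_zero (div_ne_zero (gridRoot_ne_zero hq hα l) (by positivity)) ?_
  exact (Real.sqrt_pos.2 (by positivity)).ne'

theorem a_sq (hq : 0 < q) (hα : α ≠ 0) (hβ : 0 ≤ β) (l : ℤ) :
    a q α β l ^ 2 = q * gridSq q α l / (1 + q * gridSq q α l) ^ 2 *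
      ((β + gridSq q α l) * (1 + β * (q ^ 2 * gridSq q α l)) /
        ((1 + gridSq q α l) * (1 + q ^ 2 * gridSq q α l))) := by
  have hX := gridSq_pos hq hα l
  rw [a_eq hq, mul_pow, div_pow, gridRoot_sq hq, Real.sq_sqrt (by positivity)]

theorem b_eq (hq : 0 < q) (hα : α ≠ 0) (l : ℤ) :
    b q α β l = 1 - coefA q β (gridSq q α l) - coefB q β (gridSq q α l) := by
  have hX := gridSq_pos hq hα l
  have h1 : α ^ 2 * q ^ (2 * l - 1) = gridSq q α l / q := by
    unfold gridSq; rw [zpow_sub₀ hq.ne', zpow_one]; ring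
  have h2 : α ^ (-2 : ℤ) * q ^ (-2 * l) = (gridSq q α l)⁻¹ := by
    unfold gridSq
    rw [mul_inv, neg_mul, zpow_neg, zpow_neg]
    norm_cast
  have h3 : α ^ (-2 : ℤ) * q ^ (-2 * l - 1) = (gridSq q α l)⁻¹ / q := by
    rw [zpow_sub₀ hq.ne', zpow_one, ← h2]; ring
  unfold b
  rw [mul_assoc β, mul_assoc β, h1, h2, h3, show α ^ 2 * q ^ (2 * l) = gridSq q α l from rfl]
  unfold coefA coefB
  congr 1
  field_simp
  ring

/-- The diagonal coefficient depends on `β` only through the factor `1 - β q`. -/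
theorem b_eq_mul (hq : 0 < q) (hα : α ≠ 0) (l : ℤ) :
    b q α β l = (1 - β * q) * (gridSq q α l / (1 + gridSq q α l) *
      (1 / (q + gridSq q α l) + 1 / (1 + q * gridSq q α l))) := by
  have hX := gridSq_pos hq hα l
  rw [b_eq hq hα]
  unfold coefA coefB
  generalize gridSq q α l = X at hX ⊢
  field_simp
  ring

/-! ### The weight -/

theorem zprod_succ {u : ℤ → ℝ} (hu : ∀ k, u k ≠ 0) (l : ℤ) :
    zprod u (l + 1) = u l * zprod u l := by
  unfold zprod
  rcases le_or_gt 0 l with hl | hl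
  · rw [Finset.Ico_eq_empty_of_le (show (0 : ℤ) ≤ l + 1 by lia), Finset.Ico_eq_empty_of_le hl,
      ← Finset.insert_Ico_right_eq_Ico_add_one hl, Finset.prod_insert (by simp)]
    simp
  · rw [Finset.Ico_eq_empty_of_le (show l + 1 ≤ 0 by lia), Finset.Ico_eq_empty_of_le hl.le,
      ← Finset.insert_Ico_add_one_left_eq_Ico hl, Finset.prod_insert (by simp)]
    have := hu l
    simp [this]

theorem zprod_pos {u : ℤ → ℝ} (hu : ∀ k, 0 < u k) (l : ℤ) : 0 < zprod u l :=
  mul_pos (Finset.prod_pos fun k _ => hu k) (Finset.prod_pos fun k _ => inv_pos.2 (hu k))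

/-- The ratio `w_{l+1} / w_l` of two consecutive weights. -/
def weightRatio (q α β : ℝ) (l : ℤ) : ℝ :=
  gridRoot q α l * √((1 + q ^ 2 * gridSq q α l) * (β + gridSq q α l) /
    ((1 + gridSq q α l) * (1 + β * (q ^ 2 * gridSq q α l))))

theorem zprodRatio_eq (hq : 0 < q) (k : ℤ) :
    (β + α ^ 2 * q ^ (2 * k)) / (1 + β * α ^ 2 * q ^ (2 * k + 2)) =
      (β + gridSq q α k) / (1 + β * (q ^ 2 * gridSq q α k)) := by
  unfold gridSq
  rw [zpow_add₀ hq.ne']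
  norm_cast
  ring_nf

theorem weight_ne_zero (hq : 0 < q) (hα : α ≠ 0) (hβ : 0 ≤ β) (l : ℤ) : weight q α β l ≠ 0 := by
  have hz := zprod_pos (u := fun k => (β + α ^ 2 * q ^ (2 * k)) /
    (1 + β * α ^ 2 * q ^ (2 * k + 2))) (fun k => by positivity) l
  unfold weight
  have h1 := Real.sqrt_pos.2 hz
  positivity

theorem weight_succ (hq : 0 < q) (hα : α ≠ 0) (hβ : 0 ≤ β) (l : ℤ) :
    weight q α β (l + 1) = weightRatio q α β l * weight q α β l := by
  have hX := gridSq_pos hq hα l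
  have hu : ∀ k : ℤ, 0 < (β + α ^ 2 * q ^ (2 * k)) / (1 + β * α ^ 2 * q ^ (2 * k + 2)) :=
    fun k => by positivity
  have hz := zprod_pos hu l
  unfold weight
  rw [zprod_succ (fun k => (hu k).ne'), Real.sqrt_mul (hu l).le, zprodRatio_eq hq]
  rw [show α ^ 2 * q ^ (2 * (l + 1)) = q ^ 2 * gridSq q α l from gridSq_succ hq l,
    show α ^ 2 * q ^ (2 * l) = gridSq q α l from rfl]
  have hpow : α ^ (l + 1) * q ^ (((l + 1 : ℤ) : ℝ) ^ 2 / 2) =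
      gridRoot q α l * (α ^ l * q ^ ((l : ℝ) ^ 2 / 2)) := by
    unfold gridRoot
    rw [zpow_add_one₀ hα, show ((l + 1 : ℤ) : ℝ) ^ 2 / 2 = ((l : ℝ) + 1 / 2) + (l : ℝ) ^ 2 / 2 by
      push_cast; ring, Real.rpow_add hq]
    ring
  have hsqrt : √(1 + q ^ 2 * gridSq q α l) *
      √((β + gridSq q α l) / (1 + β * (q ^ 2 * gridSq q α l))) =
      √((1 + q ^ 2 * gridSq q α l) * (β + gridSq q α l) /
        ((1 + gridSq q α l) * (1 + β * (q ^ 2 * gridSq q α l)))) * √(1 + gridSq q α l) := by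
    rw [← Real.sqrt_mul (by positivity), ← Real.sqrt_mul (by positivity)]
    congr 1
    field_simp
  unfold weightRatio
  rw [hpow]
  linear_combination (gridRoot q α l * (α ^ l * q ^ ((l : ℝ) ^ 2 / 2)) *
    √(zprod (fun k => (β + α ^ 2 * q ^ (2 * k)) / (1 + β * α ^ 2 * q ^ (2 * k + 2))) l)) * hsqrt

theorem a_mul_weightRatio (hq : 0 < q) (hα : α ≠ 0) (hβ : 0 ≤ β) (l : ℤ) :
    a q α β l * weightRatio q α β l = coefB q β (gridSq q α l) := by
  have hX := gridSq_pos hq hα l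
  have hs : √((β + gridSq q α l) * (1 + β * (q ^ 2 * gridSq q α l)) /
        ((1 + gridSq q α l) * (1 + q ^ 2 * gridSq q α l))) *
      √((1 + q ^ 2 * gridSq q α l) * (β + gridSq q α l) /
        ((1 + gridSq q α l) * (1 + β * (q ^ 2 * gridSq q α l)))) =
      (β + gridSq q α l) / (1 + gridSq q α l) := by
    rw [← Real.sqrt_mul (by positivity), ← Real.sqrt_sq (show
      0 ≤ (β + gridSq q α l) / (1 + gridSq q α l) by positivity)]
    congr 1
    field_simp
  rw [a_eq hq, weightRatio, mul_mul_mul_comm, hs, div_mul_eq_mul_div, ← sq, gridRoot_sq hq, coefB]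
  field_simp

theorem a_eq_coefA_mul (hq : 0 < q) (hα : α ≠ 0) (hβ : 0 ≤ β) (l : ℤ) :
    a q α β l = coefA q β (gridSq q α (l + 1)) * weightRatio q α β l := by
  have hX := gridSq_pos hq hα l
  have hs : √((β + gridSq q α l) * (1 + β * (q ^ 2 * gridSq q α l)) /
        ((1 + gridSq q α l) * (1 + q ^ 2 * gridSq q α l))) =
      (1 + β * (q ^ 2 * gridSq q α l)) / (1 + q ^ 2 * gridSq q α l) *
      √((1 + q ^ 2 * gridSq q α l) * (β + gridSq q α l) /
        ((1 + gridSq q α l) * (1 + β * (q ^ 2 * gridSq q α l)))) := by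
    have hk := Real.sqrt_sq (show 0 ≤ (1 + β * (q ^ 2 * gridSq q α l)) /
      (1 + q ^ 2 * gridSq q α l) by positivity)
    conv_rhs => rw [← hk]
    rw [← Real.sqrt_mul (by positivity)]
    congr 1
    field_simp
  rw [a_eq hq, hs, weightRatio, coefA, gridSq_succ hq]
  have : q ^ 2 * gridSq q α l / q = q * gridSq q α l := by field_simp
  rw [this]
  field_simp

/-! ### The `q`-difference equation of the polynomials -/

/-- The coefficient of `h_n` in `structure_relation`, as a function of `Q = q^n`. It is obtained by
eliminating `h_n(z/q)` from two equations, linear in `h_n(qz)` and `h_n(z/q)`: the `q`-difference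
equation, and the action on `h_n` of the commutator of the `q`-difference operator with
multiplication by `2x`. -/
def structCoef (q β Q z : ℝ) : ℝ :=
  ((q - 1) * Q * (1 / z - z) -
    ((q - 1) / z - (1 / q - 1) * z) * (Q - 1 + coefA q β (z ^ 2) + coefB q β (z ^ 2))) /
    ((1 / q - q) * (z + 1 / z))

/-- The recurrence coefficient of the symmetric Al-Salam–Chihara polynomials, as a function of
`Q = q^n`. -/
def recCoef (q β Q : ℝ) : ℝ := Q⁻¹ * (1 - Q) * (1 + β * q * Q⁻¹)

/-- The substitution `z ↦ -1/z`, which fixes `x = (1/z - z)/2`, exchanges the two coefficients. -/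
theorem coefB_neg_inv (hq : 0 < q) {z : ℝ} (hz : z ≠ 0) :
    coefB q β ((-1 / z) ^ 2) = coefA q β (z ^ 2) := by
  unfold coefA coefB
  field_simp
  ring

theorem coefA_neg_inv (hq : 0 < q) {z : ℝ} (hz : z ≠ 0) :
    coefA q β ((-1 / z) ^ 2) = coefB q β (z ^ 2) := by
  have hz' : -1 / z ≠ 0 := div_ne_zero (by norm_num) hz
  rw [← coefB_neg_inv hq hz']
  congr 2
  field_simp

theorem structCoef_one (hq : 0 < q) (hq1 : q < 1) {z : ℝ} (hz : z ≠ 0) :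
    structCoef q β 1 z = coefB q β (z ^ 2) := by
  unfold structCoef coefA coefB
  have h4 : 1 - q ^ 2 ≠ 0 := by nlinarith
  field_simp
  ring

theorem structCoef_add (hq : 0 < q) (hq1 : q < 1) (Q : ℝ) {z : ℝ} (hz : z ≠ 0) :
    structCoef q β Q z + structCoef q β Q (-1 / z) =
      Q - 1 + coefA q β (z ^ 2) + coefB q β (z ^ 2) := by
  unfold structCoef
  rw [coefA_neg_inv hq hz, coefB_neg_inv hq hz]
  generalize coefA q β (z ^ 2) = A
  generalize coefB q β (z ^ 2) = B
  have h4 : 1 - q ^ 2 ≠ 0 := by nlinarith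
  have e8 : -1 / z + 1 / (-1 / z) = -(z + 1 / z) := by field_simp; ring
  rw [e8]
  field_simp
  ring

/-- Comparison of the coefficients of `h_n` in the induction step of `structure_relation`. -/
theorem structCoef_rec_left (hq : 0 < q) (hq1 : q < 1) {Q z : ℝ} (hQ : Q ≠ 0) (hz : z ≠ 0) :
    (1 / (q * z) - q * z) * structCoef q β Q z +
        recCoef q β Q * (Q / q / (z + 1 / z)) =
      (1 / z - z) * structCoef q β (q * Q) z +
        recCoef q β (q * Q) * (q * Q / (z + 1 / z)) := by
  have h4 : 1 - q ^ 2 ≠ 0 := by nlinarith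
  unfold structCoef recCoef coefA coefB
  field_simp
  ring

/-- Comparison of the coefficients of `h_{n-1}` in the induction step of `structure_relation`. -/
theorem structCoef_rec_right (hq : 0 < q) (hq1 : q < 1) {Q z : ℝ} (hz : z ≠ 0) :
    (1 / (q * z) - q * z) * (Q / (z + 1 / z)) - structCoef q β (Q / q) z -
        (1 / z - z) * (Q / q / (z + 1 / z)) = -structCoef q β (q * Q) z := by
  have h4 : 1 - q ^ 2 ≠ 0 := by nlinarith
  unfold structCoef
  generalize coefA q β (z ^ 2) = A
  generalize coefB q β (z ^ 2) = B
  field_simp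
  ring

/-- `h_n^{(β)}` as a function of `z`, where `x = (1/z - z)/2`. -/
def polyAt (q β : ℝ) (n : ℕ) (z : ℝ) : ℝ := (h q β n).eval ((1 / z - z) / 2)

theorem polyAt_zero (z : ℝ) : polyAt q β 0 z = 1 := by simp [polyAt, h]

theorem polyAt_one (z : ℝ) : polyAt q β 1 z = 1 / z - z := by
  simp only [polyAt, h, Polynomial.eval_mul, Polynomial.eval_ofNat, Polynomial.eval_X]
  ring

theorem polyAt_succ_succ (hq : 0 < q) (n : ℕ) (z : ℝ) :
    polyAt q β (n + 2) z = (1 / z - z) * polyAt q β (n + 1) z -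
      recCoef q β (q ^ (n + 1)) * polyAt q β n z := by
  have : recCoef q β (q ^ (n + 1)) = (q ^ (n + 1))⁻¹ * (1 - q ^ (n + 1)) * (1 + β * (q ^ n)⁻¹) := by
    unfold recCoef
    congr 2
    rw [pow_succ]
    field_simp
  rw [this]
  simp only [polyAt, h, Polynomial.eval_sub, Polynomial.eval_mul, Polynomial.eval_ofNat,
    Polynomial.eval_X, Polynomial.eval_C]
  ring

theorem polyAt_neg_inv (n : ℕ) (z : ℝ) : polyAt q β n (-1 / z) = polyAt q β n z := by
  unfold polyAt
  congr 2
  rcases eq_or_ne z 0 with rfl | hz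
  · simp
  · field_simp; ring

/-- The structure relation expressing `h_{n+1}(x(qz))` through `h_{n+1}(x(z))` and `h_n(x(z))`.
Unlike the second-order `q`-difference equation, which it implies, it is of first order in `z`, so
that it can be proved by induction from the three-term recurrence. -/
theorem structure_relation (hq : 0 < q) (hq1 : q < 1) {z : ℝ} (hz0 : z ≠ 0) (n : ℕ) :
    coefB q β (z ^ 2) * polyAt q β (n + 1) (q * z) =
      structCoef q β (q ^ (n + 1)) z * polyAt q β (n + 1) z +
        recCoef q β (q ^ (n + 1)) * (q ^ (n + 1) / (z + 1 / z)) * polyAt q β n z := by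
  induction n using Nat.twoStepInduction with
  | zero =>
    have := structCoef_rec_left (β := β) hq hq1 one_ne_zero hz0
    rw [structCoef_one hq hq1 hz0, show recCoef q β 1 = 0 by simp [recCoef]] at this
    simp only [zero_add, pow_one, polyAt_one, polyAt_zero]
    simp only [mul_one, zero_mul, add_zero] at this ⊢
    linear_combination this
  | one =>
    have e1 := structCoef_rec_left (β := β) hq hq1 one_ne_zero hz0
    rw [structCoef_one hq hq1 hz0, show recCoef q β 1 = 0 by simp [recCoef]] at e1
    have e2 := structCoef_rec_left (β := β) hq hq1 (pow_ne_zero 1 hq.ne') hz0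
    have e3 := structCoef_rec_right (β := β) hq hq1 (Q := q) hz0
    rw [div_self hq.ne', structCoef_one hq hq1 hz0] at e3
    rw [polyAt_succ_succ hq, polyAt_succ_succ hq]
    simp only [zero_add, pow_one, polyAt_one, polyAt_zero, mul_one, zero_mul, add_zero,
      div_self hq.ne', one_add_one_eq_two] at e1 e2 e3 ⊢
    rw [← sq] at e2 e3
    linear_combination (1 / (q * z) - q * z) * e1 + (1 / z - z) * e2 + recCoef q β q * e3
  | more n ih0 ih1 =>
    have e2 := structCoef_rec_left (β := β) hq hq1 (pow_ne_zero (n + 2) hq.ne') hz0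
    have e3 := structCoef_rec_right (β := β) hq hq1 (Q := q ^ (n + 2)) hz0
    have hdiv : q ^ (n + 2) / q = q ^ (n + 1) := by rw [pow_succ q (n + 1)]; field_simp
    rw [hdiv, ← pow_succ'] at e2 e3
    have r1 := polyAt_succ_succ (β := β) hq (n + 1) (q * z)
    have r2 := polyAt_succ_succ (β := β) hq (n + 1) z
    have r3 := polyAt_succ_succ (β := β) hq n z
    simp only [add_assoc, Nat.reduceAdd] at *
    rw [r1, r2]
    linear_combination (1 / (q * z) - q * z) * ih1 - recCoef q β (q ^ (n + 2)) * ih0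
      + polyAt q β (n + 2) z * e2 + recCoef q β (q ^ (n + 2)) * polyAt q β (n + 1) z * e3
      - recCoef q β (q ^ (n + 2)) * (q ^ (n + 1) / (z + 1 / z)) * r3

/-- The second-order `q`-difference equation of the symmetric Al-Salam–Chihara polynomials. -/
theorem difference_equation (hq : 0 < q) (hq1 : q < 1) {z : ℝ} (hz0 : z ≠ 0) (n : ℕ) :
    coefB q β (z ^ 2) * polyAt q β n (q * z) + coefA q β (z ^ 2) * polyAt q β n (z / q) +
      (1 - coefA q β (z ^ 2) - coefB q β (z ^ 2)) * polyAt q β n z = q ^ n * polyAt q β n z := by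
  obtain _ | n := n
  · simp only [polyAt_zero]; ring
  have hz' : -1 / z ≠ 0 := div_ne_zero (by norm_num) hz0
  have e1 := structure_relation (β := β) hq hq1 hz0 n
  -- the relation at `-1/z`, which has the same `x`, describes `h_{n+1}(x(z/q))`
  have e2 := structure_relation (β := β) hq hq1 hz' n
  have e3 := structCoef_add (β := β) hq hq1 (q ^ (n + 1)) hz0
  have hqz : q * (-1 / z) = -1 / (z / q) := by field_simp
  have hd : -1 / z + 1 / (-1 / z) = -(z + 1 / z) := by field_simp; ring
  rw [hqz, polyAt_neg_inv, polyAt_neg_inv, polyAt_neg_inv, coefB_neg_inv hq hz0, hd, div_neg] at e2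
  linear_combination e1 + e2 + polyAt q β (n + 1) z * e3

/-! ### The operator in coordinates -/

theorem inner_weightedShift (c : ℤ → ℝ) (C D : ℝ) (hc : ∀ l, |c l| ≤ C) (s : ℤ)
    (hc' : ∀ l, |c (l - s)| ≤ D) (f g : L2Z) :
    inner ℂ (weightedShift c C hc s f) g =
      inner ℂ f (weightedShift (fun l => c (l - s)) D hc' (-s) g) := by
  rw [lp.inner_eq_tsum, lp.inner_eq_tsum, ← (Equiv.addRight (-s)).tsum_eq]
  refine tsum_congr fun l => ?_
  change inner ℂ ((c (l + -s) : ℂ) * f (l + -s + s)) (g (l + -s)) =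
    inner ℂ (f l) ((c (l - s) : ℂ) * g (l + -s))
  simp only [RCLike.inner_apply, map_mul, Complex.conj_ofReal, ← sub_eq_add_neg,
    sub_add_cancel]
  ring

theorem isSelfAdjoint_L (hq : 0 < q) (α : ℝ) (hβ : 0 ≤ β) : IsSelfAdjoint (L hq α hβ) := by
  rw [ContinuousLinearMap.isSelfAdjoint_iff_isSymmetric]
  intro f g
  change inner ℂ (weightedShift _ _ _ _ f + weightedShift _ _ _ _ f + weightedShift _ _ _ _ f) g =
    inner ℂ f (weightedShift _ _ _ _ g + weightedShift _ _ _ _ g + weightedShift _ _ _ _ g)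
  simp only [inner_add_left, inner_add_right]
  rw [inner_weightedShift _ _ _ _ 1 (fun l => abs_a_le hq α hβ (l - 1)),
    inner_weightedShift _ _ _ _ 0 (fun l => by simpa using abs_b_le hq α hβ l),
    inner_weightedShift _ _ _ _ (-1) (fun l => by simpa using abs_a_le hq α hβ l)]
  simp only [sub_zero, neg_zero, neg_neg, sub_neg_eq_add, add_sub_cancel_right]
  ring

theorem L_eq_smul_iff (hq : 0 < q) (α : ℝ) (hβ : 0 ≤ β) (f : L2Z) (μ : ℂ) :
    L hq α hβ f = μ • f ↔ ∀ l : ℤ,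
      (a q α β l : ℂ) * f (l + 1) + b q α β l * f l + a q α β (l - 1) * f (l - 1) = μ * f l := by
  constructor
  · intro h l
    rw [← L_apply hq α hβ, h]
    rfl
  · intro h
    ext l
    rw [L_apply, h]
    rfl

theorem norm_sq_L_e (hq : 0 < q) (α : ℝ) (hβ : 0 ≤ β) (l : ℤ) :
    ‖L hq α hβ (e l)‖ ^ 2 = b q α β l ^ 2 + a q α β l ^ 2 + a q α β (l - 1) ^ 2 := by
  have he : ∀ k, ‖e k‖ = 1 := fun k => by
    simp [e, lp.norm_single (p := 2) (by simp : (0 : ℝ≥0∞) < 2)]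
  have hne : ∀ i j : ℤ, i ≠ j → inner ℂ (e i) (e j) = 0 := by
    intro i j hij
    rw [e, lp.inner_single_left]
    simp [e, lp.single_apply, hij]
  rw [L_e, sq, norm_add_sq_eq_norm_sq_add_norm_sq_of_inner_eq_zero (𝕜 := ℂ),
    norm_add_sq_eq_norm_sq_add_norm_sq_of_inner_eq_zero (𝕜 := ℂ)]
  · simp only [norm_smul, he, Complex.norm_real, Real.norm_eq_abs, mul_one, abs_mul_abs_self]
    ring
  · rw [inner_smul_left, inner_smul_right, hne _ _ (by lia)]; simp
  · rw [inner_add_left, inner_smul_left, inner_smul_left, inner_smul_right, inner_smul_right,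
      hne _ _ (by lia), hne _ _ (by lia)]
    simp

/-- The standard orthonormal basis of `ℓ²(ℤ)`. -/
def stdBasis : HilbertBasis ℤ ℂ L2Z := HilbertBasis.ofRepr (LinearIsometryEquiv.refl ℂ L2Z)

theorem stdBasis_apply (l : ℤ) : stdBasis l = e l := by
  rw [← stdBasis.repr_symm_single l]
  rfl

/-! ### The Hilbert–Schmidt norm -/

theorem tendsto_gridSq_atTop (hq : 0 < q) (hq1 : q < 1) (α : ℝ) :
    Tendsto (gridSq q α) atTop (𝓝 0) := by
  have h1 : Tendsto (fun l : ℤ => (q ^ 2) ^ ((l : ℤ) : ℝ)) atTop (𝓝 0) :=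
    (tendsto_rpow_atTop_of_base_lt_one (q ^ 2) (by nlinarith) (by nlinarith)).comp
      tendsto_intCast_atTop_atTop
  have h2 := h1.const_mul (α ^ 2)
  rw [mul_zero] at h2
  refine h2.congr fun l => ?_
  rw [Real.rpow_intCast, gridSq, zpow_mul]
  norm_cast

theorem gridSq_neg (q α : ℝ) (l : ℤ) : gridSq q α (-l) = (gridSq q α⁻¹ l)⁻¹ := by
  unfold gridSq
  rw [mul_neg, zpow_neg, mul_inv, inv_pow, inv_inv]

theorem tendsto_gridSq_atBot (hq : 0 < q) (hq1 : q < 1) (hα : α ≠ 0) :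
    Tendsto (gridSq q α) atBot atTop := by
  have h1 : Tendsto (gridSq q α⁻¹) atTop (𝓝[>] 0) :=
    tendsto_nhdsWithin_iff.2 ⟨tendsto_gridSq_atTop hq hq1 α⁻¹,
      Eventually.of_forall fun l => gridSq_pos hq (inv_ne_zero hα) l⟩
  have h2 := (tendsto_inv_nhdsGT_zero.comp h1).comp tendsto_neg_atBot_atTop
  refine h2.congr fun l => ?_
  simp only [Function.comp]
  rw [← gridSq_neg, neg_neg]

theorem sum_sub_le_of_monotone {G : ℤ → ℝ} (hG : Monotone G) {S : ℝ} (h1 : Tendsto G atTop (𝓝 S))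
    (h0 : Tendsto G atBot (𝓝 0)) (t : Finset ℤ) : ∑ l ∈ t, (G (l + 1) - G l) ≤ S := by
  have htel : ∀ (m : ℤ) (n : ℕ), ∑ l ∈ Finset.Ico m (m + n), (G (l + 1) - G l) =
      G (m + n) - G m := by
    intro m n
    induction n with
    | zero => simp
    | succ n ih =>
      push_cast
      rw [← add_assoc, ← Finset.insert_Ico_right_eq_Ico_add_one (by lia),
        Finset.sum_insert (by simp), ih]
      ring
  obtain ⟨N, hN⟩ : ∃ N : ℕ, t ⊆ Finset.Ico (-N : ℤ) (-N + (2 * N : ℕ)) := by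
    refine ⟨∑ l ∈ t, (l.natAbs + 1), fun l hl => ?_⟩
    have := Finset.single_le_sum (f := fun l : ℤ => l.natAbs + 1) (fun _ _ => Nat.zero_le _) hl
    rw [Finset.mem_Ico]
    lia
  calc ∑ l ∈ t, (G (l + 1) - G l)
      ≤ ∑ l ∈ Finset.Ico (-N : ℤ) (-N + (2 * N : ℕ)), (G (l + 1) - G l) :=
        Finset.sum_le_sum_of_subset_of_nonneg hN
          fun l _ _ => sub_nonneg.2 (hG (by lia))
    _ = _ := htel _ _
    _ ≤ S - 0 := sub_le_sub (hG.ge_of_tendsto h1 _) (hG.le_of_tendsto h0 _)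
    _ = S := sub_zero S

/-- The function of `X` whose differences `hsPrim (q² X) - hsPrim X` are the squared norms
`‖L e_l‖²`, `X = α² q^{2l}`. Matching the poles at `X = -1` and `X = -q²` determines it up to the
coefficient of `1/(1 + X/q)`, which is fixed by the value at `X = 0`. -/
def hsPrim (q β X : ℝ) : ℝ :=
  -(q * (1 - β) * (1 - β * q ^ 2) / ((1 - q) ^ 2 * (1 - q ^ 2))) *
      (1 / (1 + X) + 1 / (1 + X / q ^ 2)) +
    ((1 + β ^ 2 * q ^ 2) / (1 - q ^ 2) +
      2 * (q * (1 - β) * (1 - β * q ^ 2) / ((1 - q) ^ 2 * (1 - q ^ 2)))) * (1 / (1 + X / q))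

theorem norm_sq_L_e_eq_sub (hq : 0 < q) (hq1 : q < 1) (hα : α ≠ 0) (hβ : 0 ≤ β) (l : ℤ) :
    ‖L hq α hβ (e l)‖ ^ 2 = hsPrim q β (gridSq q α (l + 1)) - hsPrim q β (gridSq q α l) := by
  have hX := gridSq_pos hq hα (l - 1)
  rw [norm_sq_L_e, a_sq hq hα hβ, a_sq hq hα hβ, b_eq_mul hq hα]
  have e1 : gridSq q α l = q ^ 2 * gridSq q α (l - 1) := by
    rw [← gridSq_succ hq, sub_add_cancel]
  rw [gridSq_succ hq, e1]
  generalize gridSq q α (l - 1) = X at hX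
  unfold hsPrim
  have h1 : 1 - q ≠ 0 := by linarith
  have h2 : 1 - q ^ 2 ≠ 0 := by nlinarith
  field_simp
  ring

theorem sum_norm_sq_L_le (hq : 0 < q) (hq1 : q < 1) (hα : α ≠ 0) (hβ : 0 ≤ β) (t : Finset ℤ) :
    ∑ l ∈ t, ‖L hq α hβ (stdBasis l)‖ ^ 2 ≤ (1 + β ^ 2 * q ^ 2) / (1 - q ^ 2) := by
  simp only [stdBasis_apply]
  have hstep := norm_sq_L_e_eq_sub hq hq1 hα hβ
  simp only [hstep]
  refine sum_sub_le_of_monotone (G := fun l => hsPrim q β (gridSq q α l)) ?_ ?_ ?_ t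
  · refine monotone_int_of_le_succ fun l => ?_
    rw [← sub_nonneg, ← hstep]
    positivity
  · have hX := tendsto_gridSq_atTop hq hq1 α
    have hcont : ContinuousAt (hsPrim q β) 0 := by
      unfold hsPrim
      fun_prop (disch := norm_num)
    have h0 : hsPrim q β 0 = (1 + β ^ 2 * q ^ 2) / (1 - q ^ 2) := by
      simp only [hsPrim]; ring
    rw [← h0]
    exact hcont.tendsto.comp hX
  · have hX := tendsto_gridSq_atBot hq hq1 hα
    have key : ∀ d : ℝ, 0 < d → Tendsto (fun l => 1 / (1 + gridSq q α l / d)) atBot (𝓝 0) := by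
      intro d hd
      exact (tendsto_const_nhds.div_atTop
        (tendsto_atTop_add_const_left _ _ (hX.atTop_div_const hd)))
    have h1 := key 1 one_pos
    simp only [div_one] at h1
    have := ((h1.add (key (q ^ 2) (by positivity))).const_mul
      (-(q * (1 - β) * (1 - β * q ^ 2) / ((1 - q) ^ 2 * (1 - q ^ 2))))).add ((key q hq).const_mul
      ((1 + β ^ 2 * q ^ 2) / (1 - q ^ 2) +
      2 * (q * (1 - β) * (1 - β * q ^ 2) / ((1 - q) ^ 2 * (1 - q ^ 2)))))
    simpa [hsPrim] using this

/-! ### The eigenvectors -/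

/-- The sequence `w_l h_n(x_l)`. -/
def eigSeq (q α β : ℝ) (n : ℕ) (l : ℤ) : ℝ :=
  weight q α β l * (h q β n).eval (gridPoint q α l)

theorem eigSeq_eq_polyAt (n : ℕ) (l : ℤ) :
    eigSeq q α β n l = weight q α β l * polyAt q β n (α * q ^ l) := rfl

theorem sq_mul_zpow (q α : ℝ) (l : ℤ) : (α * q ^ l) ^ 2 = gridSq q α l := by
  unfold gridSq
  rw [mul_pow, zpow_mul, zpow_ofNat, sq (q ^ l), ← mul_zpow, ← sq]

theorem eigSeq_recurrence (hq : 0 < q) (hq1 : q < 1) (hα : α ≠ 0) (hβ : 0 ≤ β) (n : ℕ) (l : ℤ) :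
    a q α β l * eigSeq q α β n (l + 1) + b q α β l * eigSeq q α β n l +
      a q α β (l - 1) * eigSeq q α β n (l - 1) = q ^ n * eigSeq q α β n l := by
  have hz0 : α * q ^ l ≠ 0 := by positivity
  have hD := difference_equation (β := β) hq hq1 hz0 n
  rw [sq_mul_zpow] at hD
  have e1 := a_mul_weightRatio hq hα hβ l
  have e2 := a_eq_coefA_mul hq hα hβ (l - 1)
  have w1 := weight_succ hq hα hβ l
  have w2 := weight_succ hq hα hβ (l - 1)
  rw [sub_add_cancel] at e2 w2
  simp only [eigSeq_eq_polyAt]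
  have z1 : α * q ^ (l + 1) = q * (α * q ^ l) := by rw [zpow_add_one₀ hq.ne']; ring
  have z2 : α * q ^ (l - 1) = α * q ^ l / q := by rw [zpow_sub_one₀ hq.ne']; field_simp
  rw [z1, z2, b_eq hq hα, w1, e2]
  rw [← e1] at hD ⊢
  linear_combination weight q α β l * hD - coefA q β (gridSq q α l) *
    polyAt q β n (α * q ^ l / q) * w2

/-- A majorant `|z| + 1/|z|` of the grid point `x_l = (1/z - z)/2`, `z = α q^l`, which grows by a
factor of at most `1/q` from `l` to `l ± 1`. -/
def gridBound (q α : ℝ) (l : ℤ) : ℝ := |α * q ^ l| + |α * q ^ l|⁻¹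

theorem one_le_gridBound (hq : 0 < q) (hα : α ≠ 0) (l : ℤ) : 1 ≤ gridBound q α l := by
  have hz : 0 < |α * q ^ l| := by positivity
  unfold gridBound
  rcases le_total 1 |α * q ^ l| with h | h
  · have := inv_pos.2 hz; linarith
  · have := (one_le_inv₀ hz).2 h; linarith

theorem abs_gridPoint_le (l : ℤ) : |gridPoint q α l| ≤ gridBound q α l := by
  unfold gridPoint gridBound
  rw [abs_div, abs_of_pos (two_pos : (0 : ℝ) < 2), div_le_iff₀ two_pos]
  refine (abs_sub _ _).trans ?_
  rw [abs_div, abs_one, one_div]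
  have h1 := abs_nonneg (α * q ^ l)
  have h2 := inv_nonneg.2 h1
  linarith

theorem gridBound_succ_le (hq : 0 < q) (hq1 : q < 1) (hα : α ≠ 0) (l : ℤ) :
    gridBound q α (l + 1) ≤ gridBound q α l / q := by
  have hz : 0 < |α * q ^ l| := by positivity
  have z1 : |α * q ^ (l + 1)| = q * |α * q ^ l| := by
    rw [zpow_add_one₀ hq.ne', ← mul_assoc, abs_mul, abs_of_pos hq]; ring
  unfold gridBound
  rw [z1, le_div_iff₀ hq]
  have : (q * |α * q ^ l| + (q * |α * q ^ l|)⁻¹) * q = q ^ 2 * |α * q ^ l| + |α * q ^ l|⁻¹ := by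
    field_simp
  rw [this]
  nlinarith [mul_nonneg hz.le (show 0 ≤ 1 - q ^ 2 by nlinarith)]

theorem gridBound_pred_le (hq : 0 < q) (hq1 : q < 1) (hα : α ≠ 0) (l : ℤ) :
    gridBound q α l ≤ gridBound q α (l + 1) / q := by
  have z1 : |α * q ^ (l + 1)| = q * |α * q ^ l| := by
    rw [zpow_add_one₀ hq.ne', ← mul_assoc, abs_mul, abs_of_pos hq]; ring
  unfold gridBound
  rw [z1, le_div_iff₀ hq]
  have e : (q * |α * q ^ l|)⁻¹ = q⁻¹ * |α * q ^ l|⁻¹ := by rw [mul_inv]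
  have hi : 0 < |α * q ^ l|⁻¹ := by positivity
  have : q ≤ q⁻¹ := hq1.le.trans ((one_le_inv₀ hq).2 hq1.le)
  rw [e]
  nlinarith [mul_le_mul_of_nonneg_right this hi.le]

theorem exists_abs_eval_le (P : Polynomial ℝ) :
    ∃ C : ℝ, ∀ x y : ℝ, |x| ≤ y → 1 ≤ y → |P.eval x| ≤ C * y ^ P.natDegree := by
  refine ⟨∑ i ∈ Finset.range (P.natDegree + 1), |P.coeff i|, fun x y hxy hy => ?_⟩
  rw [Polynomial.eval_eq_sum_range, Finset.sum_mul]
  refine (Finset.abs_sum_le_sum_abs _ _).trans (Finset.sum_le_sum fun i hi => ?_)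
  rw [abs_mul, abs_pow]
  gcongr
  calc |x| ^ i ≤ y ^ i := by gcongr
    _ ≤ y ^ P.natDegree := pow_le_pow_right₀ hy (by simpa [Nat.lt_succ_iff] using hi)

theorem weightRatio_sq (hq : 0 < q) (hα : α ≠ 0) (hβ : 0 ≤ β) (l : ℤ) :
    weightRatio q α β l ^ 2 = q * gridSq q α l *
      ((1 + q ^ 2 * gridSq q α l) * (β + gridSq q α l) /
        ((1 + gridSq q α l) * (1 + β * (q ^ 2 * gridSq q α l)))) := by
  have hX := gridSq_pos hq hα l
  rw [weightRatio, mul_pow, gridRoot_sq hq, Real.sq_sqrt (by positivity)]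

theorem weight_sq_succ_le (hq : 0 < q) (hq1 : q < 1) (hα : α ≠ 0) (hβ : 0 ≤ β) (l : ℤ) :
    weight q α β (l + 1) ^ 2 ≤
      gridSq q α l * (β + gridSq q α l) * weight q α β l ^ 2 := by
  have hX := gridSq_pos hq hα l
  rw [weight_succ hq hα hβ, mul_pow, weightRatio_sq hq hα hβ]
  refine mul_le_mul_of_nonneg_right ?_ (sq_nonneg _)
  generalize gridSq q α l = X at hX
  rw [← mul_div_assoc, div_le_iff₀ (by positivity)]
  have h1 : q * (1 + q ^ 2 * X) ≤ 1 * (1 + X) := by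
    have h0 : q ^ 2 * X ≤ X := mul_le_of_le_one_left hX.le (by nlinarith)
    exact mul_le_mul hq1.le (by linarith) (by positivity) zero_le_one
  have h2 : (1 : ℝ) ≤ 1 + β * (q ^ 2 * X) := by
    have : 0 ≤ β * (q ^ 2 * X) := by positivity
    linarith
  calc q * X * ((1 + q ^ 2 * X) * (β + X)) = X * (β + X) * (q * (1 + q ^ 2 * X)) := by ring
    _ ≤ X * (β + X) * ((1 * (1 + X)) * (1 + β * (q ^ 2 * X))) := by
        refine mul_le_mul_of_nonneg_left ?_ (by positivity)
        exact h1.trans (le_mul_of_one_le_right (by positivity) h2)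
    _ = _ := by ring

theorem weight_sq_pred_le (hq : 0 < q) (hq1 : q < 1) (hα : α ≠ 0) (hβ : 0 ≤ β) (l : ℤ) :
    weight q α β l ^ 2 ≤
      (q ^ 3)⁻¹ * ((gridSq q α l)⁻¹ * (β + (gridSq q α l)⁻¹)) * weight q α β (l + 1) ^ 2 := by
  have hX := gridSq_pos hq hα l
  rw [weight_succ hq hα hβ, mul_pow, weightRatio_sq hq hα hβ, ← mul_assoc]
  refine le_mul_of_one_le_left (by positivity) ?_
  generalize gridSq q α l = X at hX
  have e : (q ^ 3)⁻¹ * (X⁻¹ * (β + X⁻¹)) *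
      (q * X * ((1 + q ^ 2 * X) * (β + X) / ((1 + X) * (1 + β * (q ^ 2 * X))))) =
      ((β * X + 1) * (1 + q ^ 2 * X) * (β + X)) /
        (q ^ 2 * X * ((1 + X) * (1 + β * (q ^ 2 * X)))) := by
    field_simp
  rw [e, le_div_iff₀ (by positivity), one_mul]
  have h1 : q ^ 2 * (1 + X) ≤ 1 + q ^ 2 * X := by nlinarith
  have h2 : X * (1 + β * (q ^ 2 * X)) ≤ (β * X + 1) * (β + X) := by
    have h3 : q ^ 2 * (β * X * X) ≤ 1 * (β * X * X) := by gcongr; nlinarith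
    nlinarith [mul_nonneg (mul_nonneg hβ hβ) hX.le]
  calc q ^ 2 * X * ((1 + X) * (1 + β * (q ^ 2 * X)))
      = q ^ 2 * (1 + X) * (X * (1 + β * (q ^ 2 * X))) := by ring
    _ ≤ (1 + q ^ 2 * X) * ((β * X + 1) * (β + X)) := by gcongr
    _ = _ := by ring

theorem summable_of_ratio_tendsto_zero {f r : ℕ → ℝ} (hf : ∀ n, 0 ≤ f n)
    (hr : Tendsto r atTop (𝓝 0)) (h : ∀ n, f (n + 1) ≤ r n * f n) : Summable f := by
  refine summable_of_ratio_norm_eventually_le (r := 1 / 2) (by norm_num) ?_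
  filter_upwards [hr.eventually (gt_mem_nhds (show (0 : ℝ) < 1 / 2 by norm_num))] with n hn
  rw [Real.norm_of_nonneg (hf _), Real.norm_of_nonneg (hf _)]
  exact (h n).trans (mul_le_mul_of_nonneg_right hn.le (hf n))

theorem summable_weight_mul_gridBound (hq : 0 < q) (hq1 : q < 1) (hα : α ≠ 0) (hβ : 0 ≤ β)
    (K : ℕ) : Summable fun l : ℤ => weight q α β l ^ 2 * gridBound q α l ^ K := by
  have hy : ∀ l, 0 ≤ gridBound q α l := fun l => zero_le_one.trans (one_le_gridBound hq hα l)
  refine Summable.of_nat_of_neg ?_ ?_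
  · have hX : Tendsto (fun n : ℕ => gridSq q α (n : ℤ)) atTop (𝓝 0) :=
      (tendsto_gridSq_atTop hq hq1 α).comp tendsto_natCast_atTop_atTop
    have hr := (hX.mul (hX.const_add β)).mul_const ((q ^ K)⁻¹)
    rw [zero_mul, zero_mul] at hr
    refine summable_of_ratio_tendsto_zero (fun n => ?_) hr fun n => ?_
    · have := hy n
      positivity
    · have h1 := weight_sq_succ_le hq hq1 hα hβ n
      have h2 := pow_le_pow_left₀ (hy _) (gridBound_succ_le hq hq1 hα n) K
      have hp := gridSq_pos hq hα n
      push_cast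
      refine (mul_le_mul h1 h2 (pow_nonneg (hy _) _) (by positivity)).trans (le_of_eq ?_)
      rw [div_pow]
      ring
  · have hX : Tendsto (fun n : ℕ => (gridSq q α (-((n + 1 : ℕ) : ℤ)))⁻¹) atTop (𝓝 0) := by
      have := (tendsto_gridSq_atTop hq hq1 α⁻¹).comp
        ((tendsto_natCast_atTop_atTop (R := ℤ)).comp (tendsto_add_atTop_nat 1))
      refine this.congr fun n => ?_
      simp only [Function.comp]
      rw [gridSq_neg, inv_inv]
    have hr := ((hX.mul (hX.const_add β)).const_mul (q ^ 3)⁻¹).mul_const ((q ^ K)⁻¹)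
    rw [zero_mul, mul_zero, zero_mul] at hr
    refine summable_of_ratio_tendsto_zero (fun n => ?_) hr fun n => ?_
    · have := hy (-n)
      positivity
    · have h1 := weight_sq_pred_le hq hq1 hα hβ (-((n + 1 : ℕ) : ℤ))
      have h2 := pow_le_pow_left₀ (hy _) (gridBound_pred_le hq hq1 hα (-((n + 1 : ℕ) : ℤ))) K
      have hp := gridSq_pos hq hα (-((n + 1 : ℕ) : ℤ))
      have e : -((n + 1 : ℕ) : ℤ) + 1 = -(n : ℤ) := by push_cast; ring
      rw [e] at h1 h2
      refine (mul_le_mul h1 h2 (pow_nonneg (hy _) _) (by positivity)).trans (le_of_eq ?_)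
      rw [div_pow]
      ring

theorem summable_eigSeq_sq (hq : 0 < q) (hq1 : q < 1) (hα : α ≠ 0) (hβ : 0 ≤ β) (n : ℕ) :
    Summable fun l : ℤ => eigSeq q α β n l ^ 2 := by
  obtain ⟨C, hC⟩ := exists_abs_eval_le (h q β n)
  refine Summable.of_nonneg_of_le (fun l => sq_nonneg _) (fun l => ?_)
    ((summable_weight_mul_gridBound hq hq1 hα hβ ((h q β n).natDegree * 2)).mul_left (C ^ 2))
  have h1 := hC _ _ (abs_gridPoint_le (q := q) (α := α) l) (one_le_gridBound hq hα l)
  have h2 := pow_le_pow_left₀ (abs_nonneg _) h1 2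
  rw [sq_abs, mul_pow, ← pow_mul] at h2
  calc eigSeq q α β n l ^ 2 = weight q α β l ^ 2 * (h q β n).eval (gridPoint q α l) ^ 2 := by
        rw [eigSeq, mul_pow]
    _ ≤ weight q α β l ^ 2 * (C ^ 2 * gridBound q α l ^ ((h q β n).natDegree * 2)) := by gcongr
    _ = _ := by ring

/-- A square-summable real sequence as an element of the complex space `ℓ²(ℤ)`. -/
def ofSq (f : ℤ → ℝ) (hf : Summable fun l => f l ^ 2) : L2Z :=
  ⟨fun l => (f l : ℂ), memℓp_gen (by simpa using hf)⟩

theorem ofSq_apply (f : ℤ → ℝ) (hf : Summable fun l => f l ^ 2) (l : ℤ) :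
    ofSq f hf l = (f l : ℂ) := rfl

theorem ofSq_ne_zero {f : ℤ → ℝ} (hf : Summable fun l => f l ^ 2) {l : ℤ} (hl : f l ≠ 0) :
    ofSq f hf ≠ 0 := by
  intro h0
  have : ofSq f hf l = 0 := by rw [h0]; rfl
  rw [ofSq_apply] at this
  exact hl (Complex.ofReal_eq_zero.1 this)

/-- The leading coefficient of `h_n` is `2^n`, so that `h_n ≠ 0`. -/
theorem natDegree_h_le_and_coeff_h (q β : ℝ) (n : ℕ) :
    (h q β n).natDegree ≤ n ∧ (h q β n).coeff n = 2 ^ n := by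
  induction n using Nat.twoStepInduction with
  | zero => simp [h]
  | one =>
    have : h q β 1 = Polynomial.C 2 * Polynomial.X := by rw [h, map_ofNat]
    rw [this]
    exact ⟨(Polynomial.natDegree_C_mul_le _ _).trans Polynomial.natDegree_X_le, by simp⟩
  | more n ih0 ih1 =>
    set k := (q ^ (n + 1))⁻¹ * (1 - q ^ (n + 1)) * (1 + β * (q ^ n)⁻¹) with hk
    have : h q β (n + 2) = Polynomial.C 2 * (h q β (n + 1) * Polynomial.X)
        - Polynomial.C k * h q β n := by
      rw [h, ← hk, map_ofNat]; ring
    rw [this]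
    constructor
    · refine (Polynomial.natDegree_sub_le _ _).trans (max_le ?_ ?_)
      · refine (Polynomial.natDegree_C_mul_le _ _).trans (Polynomial.natDegree_mul_le.trans ?_)
        rw [Polynomial.natDegree_X]
        lia
      · exact (Polynomial.natDegree_C_mul_le _ _).trans (by lia)
    · rw [Polynomial.coeff_sub, Polynomial.coeff_C_mul, Polynomial.coeff_C_mul,
        Polynomial.coeff_mul_X, ih1.2,
        Polynomial.coeff_eq_zero_of_natDegree_lt (p := h q β n) (by lia)]
      ring

theorem gridPoint_injective (hq : 0 < q) (hq1 : q < 1) (hα : α ≠ 0) :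
    Function.Injective (gridPoint q α) := by
  intro k l hkl
  have hz : ∀ k : ℤ, α * q ^ k ≠ 0 := fun k => by positivity
  unfold gridPoint at hkl
  have h1 : (α * q ^ k - α * q ^ l) * (1 + (α * q ^ k) * (α * q ^ l)) = 0 := by
    have := hz k
    have := hz l
    have e : 1 / (α * q ^ k) - α * q ^ k = 1 / (α * q ^ l) - α * q ^ l := by linarith
    generalize α * q ^ k = x at *
    generalize α * q ^ l = y at *
    field_simp at e
    linear_combination -e
  have h2 : 1 + (α * q ^ k) * (α * q ^ l) ≠ 0 := by
    have : (α * q ^ k) * (α * q ^ l) = α ^ 2 * (q ^ k * q ^ l) := by ring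
    rw [this]; positivity
  have h3 := (mul_eq_zero.1 h1).resolve_right h2
  have h4 : q ^ k = q ^ l := mul_left_cancel₀ hα (by linarith)
  exact zpow_right_injective₀ hq hq1.ne h4

theorem exists_eigSeq_ne_zero (hq : 0 < q) (hq1 : q < 1) (hα : α ≠ 0) (hβ : 0 ≤ β) (n : ℕ) :
    ∃ l, eigSeq q α β n l ≠ 0 := by
  by_contra hcon
  push Not at hcon
  have h0 : h q β n = 0 := by
    refine Polynomial.eq_zero_of_infinite_isRoot _
      ((Set.infinite_range_of_injective (gridPoint_injective hq hq1 hα)).mono ?_)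
    rintro _ ⟨l, rfl⟩
    exact (mul_eq_zero.1 (hcon l)).resolve_left (weight_ne_zero hq hα hβ l)
  have := (natDegree_h_le_and_coeff_h q β n).2
  rw [h0, Polynomial.coeff_zero] at this
  exact pow_ne_zero n two_ne_zero this.symm

/-- The eigenvector of `L` with eigenvalue `q^n`. -/
def eigVec (hq : 0 < q) (hq1 : q < 1) (hα : α ≠ 0) (hβ : 0 ≤ β) (n : ℕ) : L2Z :=
  ofSq (eigSeq q α β n) (summable_eigSeq_sq hq hq1 hα hβ n)

theorem eigVec_ne_zero (hq : 0 < q) (hq1 : q < 1) (hα : α ≠ 0) (hβ : 0 ≤ β) (n : ℕ) :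
    eigVec hq hq1 hα hβ n ≠ 0 :=
  let ⟨_, hl⟩ := exists_eigSeq_ne_zero hq hq1 hα hβ n
  ofSq_ne_zero _ hl

theorem L_eigVec (hq : 0 < q) (hq1 : q < 1) (hα : α ≠ 0) (hβ : 0 ≤ β) (n : ℕ) :
    L hq α hβ (eigVec hq hq1 hα hβ n) = ((q ^ n : ℝ) : ℂ) • eigVec hq hq1 hα hβ n := by
  rw [L_eq_smul_iff]
  intro l
  simp only [eigVec, ofSq_apply]
  exact_mod_cast eigSeq_recurrence hq hq1 hα hβ n l

/-! ### The negative eigenvalues -/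

theorem a_eq_mul_a_dual (hq : 0 < q) (hα : α ≠ 0) (hβ : 0 < β) (l : ℤ) :
    a q α β l = β * q * a q α (1 / (β * q ^ 2)) l := by
  have hX := gridSq_pos hq hα l
  have hs : √((β + gridSq q α l) * (1 + β * (q ^ 2 * gridSq q α l)) /
        ((1 + gridSq q α l) * (1 + q ^ 2 * gridSq q α l))) =
      β * q * √((1 / (β * q ^ 2) + gridSq q α l) *
        (1 + 1 / (β * q ^ 2) * (q ^ 2 * gridSq q α l)) /
        ((1 + gridSq q α l) * (1 + q ^ 2 * gridSq q α l))) := by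
    have hk := Real.sqrt_sq (show 0 ≤ β * q by positivity)
    conv_rhs => rw [← hk]
    rw [← Real.sqrt_mul (by positivity)]
    congr 1
    field_simp
  rw [a_eq hq, a_eq hq, hs]
  ring

theorem b_eq_mul_b_dual (hq : 0 < q) (hα : α ≠ 0) (hβ : 0 < β) (l : ℤ) :
    b q α β l = -(β * q) * b q α (1 / (β * q ^ 2)) l := by
  have hk : 1 - β * q = -(β * q) * (1 - 1 / (β * q ^ 2) * q) := by
    field_simp
    ring
  rw [b_eq_mul hq hα, b_eq_mul hq hα, hk, mul_assoc]

/-- The eigenvector of `L` with eigenvalue `-β q^{n+1}`. -/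
def negEigVec (hq : 0 < q) (hq1 : q < 1) (hα : α ≠ 0) (hβ : 0 < β) (n : ℕ) : L2Z :=
  ofSq (fun l => (-1) ^ l * eigSeq q α (1 / (β * q ^ 2)) n l) <| by
    have := summable_eigSeq_sq hq hq1 hα (show 0 ≤ 1 / (β * q ^ 2) by positivity) n
    refine this.congr fun l => ?_
    have hs : ((-1 : ℝ) ^ l) ^ 2 = 1 := by rw [sq, ← mul_zpow]; simp
    rw [mul_pow, hs, one_mul]

theorem negEigVec_ne_zero (hq : 0 < q) (hq1 : q < 1) (hα : α ≠ 0) (hβ : 0 < β) (n : ℕ) :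
    negEigVec hq hq1 hα hβ n ≠ 0 :=
  let ⟨_, hl⟩ := exists_eigSeq_ne_zero hq hq1 hα (show 0 ≤ 1 / (β * q ^ 2) by positivity) n
  ofSq_ne_zero _ (mul_ne_zero (zpow_ne_zero _ (by norm_num)) hl)

/-- `L(α, β)` is conjugate to `-β q L(α, 1/(β q²))` under `e_l ↦ (-1)^l e_l`. -/
theorem L_negEigVec (hq : 0 < q) (hq1 : q < 1) (hα : α ≠ 0) (hβ : 0 < β) (n : ℕ) :
    L hq α hβ.le (negEigVec hq hq1 hα hβ n) =
      ((-β * q ^ (n + 1) : ℝ) : ℂ) • negEigVec hq hq1 hα hβ n := by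
  rw [L_eq_smul_iff]
  intro l
  simp only [negEigVec, ofSq_apply]
  have h1 := eigSeq_recurrence hq hq1 hα (show 0 ≤ 1 / (β * q ^ 2) by positivity) n l
  have h2 : a q α β l * ((-1) ^ (l + 1) * eigSeq q α (1 / (β * q ^ 2)) n (l + 1)) +
      b q α β l * ((-1) ^ l * eigSeq q α (1 / (β * q ^ 2)) n l) +
      a q α β (l - 1) * ((-1) ^ (l - 1) * eigSeq q α (1 / (β * q ^ 2)) n (l - 1)) =
      -β * q ^ (n + 1) * ((-1) ^ l * eigSeq q α (1 / (β * q ^ 2)) n l) := by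
    rw [a_eq_mul_a_dual hq hα hβ, a_eq_mul_a_dual hq hα hβ (l - 1), b_eq_mul_b_dual hq hα hβ,
      zpow_add_one₀ (by norm_num), zpow_sub_one₀ (by norm_num), pow_succ q n, inv_neg,
      inv_one]
    linear_combination (-(β * q) * (-1) ^ l) * h1
  exact_mod_cast h2

/-! ### Simplicity of the eigenvalues -/

theorem a_sq_le (hq : 0 < q) (hα : α ≠ 0) (hβ : 0 ≤ β) (l : ℤ) :
    a q α β l ^ 2 ≤ q * gridSq q α l * (1 + β) ^ 2 := by
  have hX := gridSq_pos hq hα l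
  rw [a_sq hq hα hβ]
  have h1 := add_div_le hβ hX.le
  have h2 := one_add_mul_div_le hβ (show 0 ≤ q ^ 2 * gridSq q α l by positivity)
  rw [mul_div_mul_comm, sq (1 + β)]
  have h3 : q * gridSq q α l / (1 + q * gridSq q α l) ^ 2 ≤ q * gridSq q α l := by
    refine div_le_self (by positivity) (one_le_pow₀ ?_)
    have : 0 < q * gridSq q α l := by positivity
    linarith
  gcongr

/-- A solution of the eigenvalue recurrence is determined by two consecutive values. -/
theorem eq_zero_of_consecutive (hq : 0 < q) (hα : α ≠ 0) (hβ : 0 ≤ β) {f : ℤ → ℂ} {μ : ℂ}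
    (hf : ∀ l : ℤ, (a q α β l : ℂ) * f (l + 1) + b q α β l * f l +
      a q α β (l - 1) * f (l - 1) = μ * f l) {m : ℤ} (h0 : f m = 0) (h1 : f (m + 1) = 0) (l : ℤ) :
    f l = 0 := by
  have ha : ∀ l, (a q α β l : ℂ) ≠ 0 := fun l => by
    exact_mod_cast a_ne_zero hq hα hβ l
  have key : ∀ l : ℤ, f l = 0 ∧ f (l + 1) = 0 := by
    intro l
    induction l using Int.inductionOn' (b := m) with
    | zero => exact ⟨h0, h1⟩
    | succ k _ ih =>
      refine ⟨ih.2, ?_⟩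
      have := hf (k + 1)
      rw [ih.2, add_sub_cancel_right, ih.1] at this
      simpa [ha] using this
    | pred k _ ih =>
      rw [sub_add_cancel]
      refine ⟨?_, ih.1⟩
      have := hf k
      rw [ih.2, ih.1] at this
      simpa [ha] using this
  exact (key l).1

/-- Two eigenvectors for the same eigenvalue are proportional: their Casorati determinant
`a_l (f_{l+1} g_l - f_l g_{l+1})` is constant, and it tends to zero since `a_l` does. -/
theorem exists_eq_smul_of_eigenvector (hq : 0 < q) (hq1 : q < 1) (hα : α ≠ 0) (hβ : 0 ≤ β)
    {μ : ℂ} {f g : L2Z} (hf : L hq α hβ f = μ • f) (hg : L hq α hβ g = μ • g) (hg0 : g ≠ 0) :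
    ∃ c : ℂ, f = c • g := by
  have hf' := (L_eq_smul_iff hq α hβ f μ).1 hf
  have hg' := (L_eq_smul_iff hq α hβ g μ).1 hg
  let W : ℤ → ℂ := fun l => a q α β l * (f (l + 1) * g l - f l * g (l + 1))
  have hstep : ∀ l, W (l + 1) = W l := by
    intro l
    have h1 := hf' (l + 1)
    have h2 := hg' (l + 1)
    rw [add_sub_cancel_right] at h1 h2
    simp only [W]
    linear_combination g (l + 1) * h1 - f (l + 1) * h2
  have hconst : ∀ n : ℕ, ∀ l : ℤ, W (l + n) = W l := by
    intro n l
    induction n with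
    | zero => simp
    | succ n ih => rw [← ih, ← hstep (l + n)]; push_cast; rw [add_assoc]
  have hbound : ∀ l, ‖W l‖ ^ 2 ≤ q * gridSq q α l * (1 + β) ^ 2 * (2 * ‖f‖ * ‖g‖) ^ 2 := by
    intro l
    have hn : ∀ (f : L2Z) (l : ℤ), ‖f l‖ ≤ ‖f‖ := fun f l =>
      lp.norm_apply_le_norm (by simp) f l
    have h1 : ‖f (l + 1) * g l - f l * g (l + 1)‖ ≤ 2 * ‖f‖ * ‖g‖ := by
      refine (norm_sub_le _ _).trans ?_
      rw [norm_mul, norm_mul]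
      have e1 := mul_le_mul (hn f (l + 1)) (hn g l) (norm_nonneg _) (norm_nonneg _)
      have e2 := mul_le_mul (hn f l) (hn g (l + 1)) (norm_nonneg _) (norm_nonneg _)
      linarith
    simp only [W]
    rw [norm_mul, mul_pow, Complex.norm_real, Real.norm_eq_abs, sq_abs]
    have hX := gridSq_pos hq hα l
    exact mul_le_mul (a_sq_le hq hα hβ l) (pow_le_pow_left₀ (norm_nonneg _) h1 2)
      (sq_nonneg _) (by positivity)
  have hW : ∀ l, W l = 0 := by
    intro l
    have hlim : Tendsto (fun n : ℕ => q * gridSq q α (l + n) * (1 + β) ^ 2 *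
        (2 * ‖f‖ * ‖g‖) ^ 2) atTop (𝓝 0) := by
      have := (tendsto_gridSq_atTop hq hq1 α).comp (tendsto_atTop_add_const_left _ l
        (tendsto_natCast_atTop_atTop (R := ℤ)))
      simpa using ((this.const_mul q).mul_const ((1 + β) ^ 2)).mul_const ((2 * ‖f‖ * ‖g‖) ^ 2)
    have : ‖W l‖ ^ 2 ≤ 0 := ge_of_tendsto' hlim fun n => by
      rw [← hconst n l]
      exact hbound (l + n)
    have h0 : ‖W l‖ ^ 2 = 0 := le_antisymm this (sq_nonneg _)
    simpa using h0
  obtain ⟨m, hm⟩ : ∃ m, g m ≠ 0 := by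
    by_contra hcon
    push Not at hcon
    exact hg0 (lp.ext (funext hcon))
  refine ⟨f m / g m, ?_⟩
  have ha : (a q α β m : ℂ) ≠ 0 := by exact_mod_cast a_ne_zero hq hα hβ m
  have hWm := (mul_eq_zero.1 (hW m)).resolve_left ha
  have hzero := eq_zero_of_consecutive (f := fun l => f l - f m / g m * g l) (μ := μ) (m := m)
    hq hα hβ (fun l => by linear_combination hf' l - f m / g m * hg' l)
    (by field_simp; ring) (by field_simp; linear_combination hWm)
  ext l
  exact sub_eq_zero.1 (hzero l)

/-! ### The kernel -/

theorem eq_zero_of_le_mul_succ {f : ℕ → ℝ} {C κ : ℝ} (hf : ∀ n, 0 ≤ f n) (hC : ∀ n, f n ≤ C)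
    (hκ0 : 0 ≤ κ) (hκ : κ < 1) (h : ∀ n, f n ≤ κ * f (n + 1)) : f 0 = 0 := by
  have key : ∀ n, f 0 ≤ κ ^ n * f n := by
    intro n
    induction n with
    | zero => simp
    | succ n ih =>
      rw [pow_succ, mul_assoc]
      exact ih.trans (mul_le_mul_of_nonneg_left (h n) (by positivity))
  have hlim : Tendsto (fun n : ℕ => κ ^ n * C) atTop (𝓝 0) := by
    simpa using (tendsto_pow_atTop_nhds_zero_of_lt_one hκ0 hκ).mul_const C
  refine le_antisymm (ge_of_tendsto' hlim fun n => (key n).trans ?_) (hf 0)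
  exact mul_le_mul_of_nonneg_left (hC n) (by positivity)

/-- For `β > 0` the coefficients satisfy `a_{l+1} / a_l → q` and `b_{l+1} / a_l → 0`. -/
theorem eventually_coef_le (hq : 0 < q) (hq1 : q < 1) (hα : α ≠ 0) (hβ : 0 < β) :
    ∀ᶠ l : ℤ in atTop,
      |b q α β (l + 1)| + |a q α β (l + 1)| ≤ (1 + q) / 2 * |a q α β l| := by
  -- `a_l = gridRoot l * P (X_l)` and `b_{l+1} = gridRoot l ^ 2 * R (X_l)`
  let P : ℝ → ℝ := fun X => 1 / (1 + q * X) *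
    √((β + X) * (1 + β * (q ^ 2 * X)) / ((1 + X) * (1 + q ^ 2 * X)))
  let R : ℝ → ℝ := fun X => |1 - β * q| * (q / (1 + q ^ 2 * X) *
    (1 / (q + q ^ 2 * X) + 1 / (1 + q * (q ^ 2 * X))))
  have hP0 : P 0 = √β := by simp [P]
  have hPc : ContinuousAt P 0 := by
    refine ContinuousAt.mul ?_ (ContinuousAt.sqrt ?_) <;> fun_prop (disch := simp)
  have hRc : ContinuousAt R 0 := by
    have := hq.ne'
    have h1 : q + q ^ 2 * 0 ≠ 0 := by simpa
    have h2 : 1 + q ^ 2 * (0 : ℝ) ≠ 0 := by simp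
    have h3 : 1 + q * (q ^ 2 * (0 : ℝ)) ≠ 0 := by simp
    fun_prop (disch := assumption)
  have hX := tendsto_gridSq_atTop hq hq1 α
  have ht : Tendsto (fun l => |gridRoot q α l|) atTop (𝓝 0) := by
    have : Tendsto (fun l => √(q * gridSq q α l)) atTop (𝓝 0) := by
      simpa using (hX.const_mul q).sqrt
    refine this.congr fun l => ?_
    rw [← gridRoot_sq hq, Real.sqrt_sq_eq_abs]
  have hPl : Tendsto (fun l => P (gridSq q α l)) atTop (𝓝 (P 0)) := hPc.tendsto.comp hX
  have hPl' : Tendsto (fun l => P (gridSq q α (l + 1))) atTop (𝓝 (P 0)) :=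
    hPl.comp (tendsto_atTop_add_const_right _ 1 tendsto_id)
  have hRl : Tendsto (fun l => R (gridSq q α l)) atTop (𝓝 (R 0)) := hRc.tendsto.comp hX
  have hlhs := (ht.mul hRl).add (hPl'.const_mul q)
  have hrhs := hPl.const_mul ((1 + q) / 2)
  have hlt : 0 * R 0 + q * P 0 < (1 + q) / 2 * P 0 := by
    have : 0 < P 0 := by rw [hP0]; exact Real.sqrt_pos.2 hβ
    nlinarith
  filter_upwards [hlhs.eventually_lt hrhs hlt] with l hl
  have hXl := gridSq_pos hq hα l
  have hPnn : ∀ l, 0 ≤ P (gridSq q α l) := fun l => by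
    have := gridSq_pos hq hα l
    positivity
  have ha : ∀ l, |a q α β l| = |gridRoot q α l| * P (gridSq q α l) := by
    intro l
    rw [← abs_of_nonneg (hPnn l), ← abs_mul, a_eq hq]
    simp only [P]
    congr 1
    ring
  have hb : |b q α β (l + 1)| = |gridRoot q α l| * (|gridRoot q α l| * R (gridSq q α l)) := by
    rw [b_eq_mul hq hα, abs_mul, gridSq_succ hq, ← mul_assoc |gridRoot q α l|, abs_mul_abs_self,
      ← sq, gridRoot_sq hq, abs_of_nonneg (a := _ / _ * _) (by positivity)]
    simp only [R]
    ring
  rw [ha, ha, hb, gridRoot_succ hq, abs_mul, abs_of_pos hq]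
  have := mul_le_mul_of_nonneg_left hl.le (abs_nonneg (gridRoot q α l))
  linarith

theorem eq_zero_of_L_eq_zero_of_pos (hq : 0 < q) (hq1 : q < 1) (hα : α ≠ 0) (hβ : 0 < β) {f : L2Z}
    (hf : L hq α hβ.le f = 0) : f = 0 := by
  have hf' := (L_eq_smul_iff hq α hβ.le f 0).1 (by rw [hf, zero_smul])
  simp only [zero_mul] at hf'
  obtain ⟨N, hN⟩ := eventually_atTop.1 (eventually_coef_le hq hq1 hα hβ)
  have hstep : ∀ l ≥ N, ‖f l‖ ≤ (1 + q) / 2 * max ‖f (l + 1)‖ ‖f (l + 2)‖ := by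
    intro l hl
    have h1 := hf' (l + 1)
    rw [add_sub_cancel_right, show l + 1 + 1 = l + 2 by ring] at h1
    have h2 : (a q α β l : ℂ) * f l =
        -((a q α β (l + 1) : ℂ) * f (l + 2) + b q α β (l + 1) * f (l + 1)) := by
      linear_combination h1
    have h3 := congrArg norm h2
    rw [norm_neg, norm_mul, Complex.norm_real, Real.norm_eq_abs] at h3
    have h4 := norm_add_le ((a q α β (l + 1) : ℂ) * f (l + 2)) (b q α β (l + 1) * f (l + 1))
    rw [norm_mul, norm_mul, Complex.norm_real, Complex.norm_real, Real.norm_eq_abs,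
      Real.norm_eq_abs] at h4
    have ha := abs_pos.2 (a_ne_zero hq hα hβ.le l)
    refine le_of_mul_le_mul_left ?_ ha
    set M := max ‖f (l + 1)‖ ‖f (l + 2)‖
    have hM : 0 ≤ M := (norm_nonneg _).trans (le_max_left _ _)
    have e1 := mul_le_mul_of_nonneg_left (le_max_left ‖f (l + 1)‖ ‖f (l + 2)‖)
      (abs_nonneg (b q α β (l + 1)))
    have e2 := mul_le_mul_of_nonneg_left (le_max_right ‖f (l + 1)‖ ‖f (l + 2)‖)
      (abs_nonneg (a q α β (l + 1)))
    have e3 := mul_le_mul_of_nonneg_right (hN l hl) hM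
    linarith
  have hbd : ∀ n : ℕ, ∀ l ≥ N, ‖f l‖ ≤ ((1 + q) / 2) ^ n * ‖f‖ := by
    intro n
    induction n with
    | zero => intro l _; simpa using lp.norm_apply_le_norm (by simp) f l
    | succ n ih =>
      intro l hl
      refine (hstep l hl).trans ?_
      rw [pow_succ', mul_assoc]
      exact mul_le_mul_of_nonneg_left (max_le (ih _ (by lia)) (ih _ (by lia))) (by linarith)
  have hz : ∀ l ≥ N, f l = 0 := by
    intro l hl
    have hlim : Tendsto (fun n : ℕ => ((1 + q) / 2) ^ n * ‖f‖) atTop (𝓝 0) := by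
      simpa using (tendsto_pow_atTop_nhds_zero_of_lt_one (by linarith)
        (show (1 + q) / 2 < 1 by linarith)).mul_const ‖f‖
    have := ge_of_tendsto' hlim fun n => hbd n l hl
    simpa using this
  exact lp.ext (funext (eq_zero_of_consecutive (μ := 0) hq hα hβ.le (by simpa using hf')
    (hz N le_rfl) (hz (N + 1) (by lia))))

/-- For `β = 0` the operator has the form `T* C T` with `C` diagonal and positive and
`(T f)_l = r_l f_l + σ r_{l+1} f_{l+1}`, where `r_l = (1 + X_l)^{-1/2}` and `σ = ± √q`. -/
theorem L_factor_of_zero (hq : 0 < q) (hα : α ≠ 0) :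
    ∃ σ : ℝ, σ ^ 2 = q ∧ ∀ l : ℤ,
      a q α 0 l = σ * (gridSq q α l / (1 + q * gridSq q α l)) *
        ((√(1 + gridSq q α l))⁻¹ * (√(1 + gridSq q α (l + 1)))⁻¹) ∧
      b q α 0 l = (√(1 + gridSq q α l))⁻¹ ^ 2 * (gridSq q α l / (1 + q * gridSq q α l) +
        q * (gridSq q α (l - 1) / (1 + q * gridSq q α (l - 1)))) := by
  refine ⟨α / |α| * √q, ?_, fun l => ⟨?_, ?_⟩⟩
  · rw [mul_pow, div_pow, sq_abs, div_self (by positivity), Real.sq_sqrt hq.le, one_mul]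
  · have hX := gridSq_pos hq hα l
    have hroot : gridRoot q α l * √(gridSq q α l) = α / |α| * √q * gridSq q α l := by
      have h1 : √(gridSq q α l) = |α| * q ^ l := by
        rw [← sq_mul_zpow, Real.sqrt_sq_eq_abs, abs_mul, abs_of_pos (zpow_pos hq l)]
      have h2 : q ^ ((l : ℝ) + 1 / 2) = q ^ l * √q := by
        rw [Real.rpow_add hq, Real.rpow_intCast, Real.sqrt_eq_rpow]
      rw [h1, gridRoot, h2, ← sq_mul_zpow]
      have h3 : α * |α| = α / |α| * α ^ 2 := by
        rw [← sq_abs α]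
        field_simp
      linear_combination q ^ l * √q * q ^ l * h3
    rw [a_eq hq, gridSq_succ hq]
    simp only [zero_add, zero_mul, add_zero, mul_one]
    rw [Real.sqrt_div hX.le, Real.sqrt_mul (by positivity), div_mul_div_comm, hroot]
    field_simp
  · have hX := gridSq_pos hq hα (l - 1)
    have e1 : gridSq q α l = q ^ 2 * gridSq q α (l - 1) := by
      rw [← gridSq_succ hq, sub_add_cancel]
    rw [b_eq_mul hq hα, inv_pow, Real.sq_sqrt (by rw [e1]; positivity), e1]
    generalize gridSq q α (l - 1) = X at hX
    field_simp
    ring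

theorem eq_zero_of_L_eq_zero_of_zero (hq : 0 < q) (hq1 : q < 1) (hα : α ≠ 0) {f : L2Z}
    (hf : L hq α le_rfl f = 0) : f = 0 := by
  have hf' := (L_eq_smul_iff hq α le_rfl f 0).1 (by rw [hf, zero_smul])
  simp only [zero_mul] at hf'
  obtain ⟨σ, hσ, hab⟩ := L_factor_of_zero hq hα
  have hσabs : |σ| = √q := by rw [← hσ, Real.sqrt_sq_eq_abs]
  have hq' : √q < 1 := by rw [Real.sqrt_lt' one_pos]; simpa using hq1
  let r : ℤ → ℝ := fun l => (√(1 + gridSq q α l))⁻¹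
  let c : ℤ → ℝ := fun l => gridSq q α l / (1 + q * gridSq q α l)
  have hr0 : ∀ l, 0 < r l := fun l => by
    have := gridSq_pos hq hα l
    positivity
  have hr1 : ∀ l, r l ≤ 1 := fun l => by
    have := gridSq_pos hq hα l
    refine inv_le_one_of_one_le₀ (Real.one_le_sqrt.2 (by linarith))
  have hc0 : ∀ l, 0 < c l := fun l => by
    have := gridSq_pos hq hα l
    positivity
  have hc1 : ∀ l, c l ≤ q⁻¹ := fun l => by
    have := gridSq_pos hq hα l
    simp only [c]
    rw [div_le_iff₀ (by positivity), mul_add, inv_mul_cancel_left₀ hq.ne']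
    have : 0 < q⁻¹ := by positivity
    linarith
  let u : ℤ → ℂ := fun l => r l * f l
  have hu : ∀ l, ‖u l‖ ≤ ‖f‖ := fun l => by
    simp only [u]
    rw [norm_mul, Complex.norm_real, Real.norm_of_nonneg (hr0 l).le]
    exact (mul_le_of_le_one_left (norm_nonneg _) (hr1 l)).trans
      (lp.norm_apply_le_norm (by simp) f l)
  let G : ℤ → ℂ := fun l => c l * (u l + σ * u (l + 1))
  have hGrec : ∀ l, G l = -σ * G (l - 1) := by
    intro l
    have h1 := hf' l
    have ea : (a q α 0 l : ℂ) = σ * c l * (r l * r (l + 1)) := by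
      rw [(hab l).1]; simp only [c, r]; push_cast; rfl
    have ea' : (a q α 0 (l - 1) : ℂ) = σ * c (l - 1) * (r (l - 1) * r l) := by
      rw [(hab (l - 1)).1, sub_add_cancel]; simp only [c, r]; push_cast; rfl
    have eb : (b q α 0 l : ℂ) = r l ^ 2 * (c l + q * c (l - 1)) := by
      rw [(hab l).2]; simp only [c, r]; push_cast; rfl
    have hσ' : (σ : ℂ) ^ 2 = q := by exact_mod_cast hσ
    rw [ea, ea', eb, ← hσ'] at h1
    have hr : (r l : ℂ) ≠ 0 := by exact_mod_cast (hr0 l).ne'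
    refine mul_left_cancel₀ hr ?_
    simp only [G, u, sub_add_cancel]
    linear_combination h1
  -- `G` grows geometrically towards `-∞` unless it vanishes
  have hG : ∀ l, G l = 0 := by
    intro l
    have := eq_zero_of_le_mul_succ (f := fun n : ℕ => ‖G (l - n)‖)
      (C := q⁻¹ * (‖f‖ + √q * ‖f‖)) (κ := √q)
      (fun n => norm_nonneg _) (fun n => ?_) (Real.sqrt_nonneg q) hq' (fun n => ?_)
    · simpa using this
    · simp only [G]
      rw [norm_mul, Complex.norm_real, Real.norm_of_nonneg (hc0 _).le]
      refine mul_le_mul (hc1 _) ((norm_add_le _ _).trans ?_) (norm_nonneg _) (by positivity)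
      rw [norm_mul (σ : ℂ), Complex.norm_real, Real.norm_eq_abs, hσabs]
      exact add_le_add (hu _) (mul_le_mul_of_nonneg_left (hu _) (Real.sqrt_nonneg q))
    · rw [hGrec, norm_mul, norm_neg, Complex.norm_real, Real.norm_eq_abs, hσabs]
      push_cast
      rw [sub_sub]
  have hurec : ∀ l, u l = -σ * u (l + 1) := by
    intro l
    have hc : (c l : ℂ) ≠ 0 := by exact_mod_cast (hc0 l).ne'
    have := (mul_eq_zero.1 (hG l)).resolve_left hc
    linear_combination this
  -- then `u` grows geometrically towards `+∞` unless it vanishes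
  have hu0 : ∀ l, u l = 0 := by
    intro l
    have := eq_zero_of_le_mul_succ (f := fun n : ℕ => ‖u (l + n)‖) (C := ‖f‖) (κ := √q)
      (fun n => norm_nonneg _) (fun n => hu _) (Real.sqrt_nonneg q) hq' (fun n => ?_)
    · simpa using this
    · rw [hurec, norm_mul, norm_neg, Complex.norm_real, Real.norm_eq_abs, hσabs]
      push_cast
      rw [add_assoc]
  ext l
  have hr : (r l : ℂ) ≠ 0 := by exact_mod_cast (hr0 l).ne'
  exact (mul_eq_zero.1 (hu0 l)).resolve_left hr

theorem eq_zero_of_L_eq_zero (hq : 0 < q) (hq1 : q < 1) (hα : α ≠ 0) (hβ : 0 ≤ β) {f : L2Z}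
    (hf : L hq α hβ f = 0) : f = 0 := by
  rcases hβ.eq_or_lt with rfl | hβ'
  · exact eq_zero_of_L_eq_zero_of_zero hq hq1 hα hf
  · exact eq_zero_of_L_eq_zero_of_pos hq hq1 hα hβ' hf

/-! ### The spectrum -/

theorem closure_range_of_tendsto_zero {u : ℕ → ℂ} (hu : Tendsto u atTop (𝓝 0)) :
    closure (Set.range u) = insert 0 (Set.range u) := by
  apply Set.Subset.antisymm
  · exact closure_minimal (Set.subset_insert _ _) hu.isCompact_insert_range.isClosed
  · refine Set.insert_subset ?_ subset_closure
    exact mem_closure_of_tendsto hu (Eventually.of_forall fun n => ⟨n, rfl⟩)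

theorem tendsto_ofReal_pow (hq : 0 < q) (hq1 : q < 1) :
    Tendsto (fun n : ℕ => ((q ^ n : ℝ) : ℂ)) atTop (𝓝 0) := by
  have := (Complex.continuous_ofReal.tendsto 0).comp
    (tendsto_pow_atTop_nhds_zero_of_lt_one hq.le hq1)
  simpa [Function.comp_def] using this

theorem hasSum_sq_pow (hq : 0 < q) (hq1 : q < 1) :
    HasSum (fun n : ℕ => (q ^ n) ^ 2) (1 / (1 - q ^ 2)) := by
  have := hasSum_geometric_of_lt_one (r := q ^ 2) (by positivity) (by nlinarith)
  rw [← one_div] at this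
  refine this.congr_fun ?_
  intro n
  rw [← pow_mul, ← pow_mul, mul_comm]

theorem spectrum_L (hq : 0 < q) (hq1 : q < 1) (hα : α ≠ 0) (hβ : 0 ≤ β) :
    spectrum ℂ (L hq α hβ) =
      {z : ℂ | ∃ n : ℕ, 1 ≤ n ∧ z = ((-β * q ^ n : ℝ) : ℂ)} ∪ {0} ∪
        {z : ℂ | ∃ n : ℕ, z = ((q ^ n : ℝ) : ℂ)} := by
  have hpow := closure_range_of_tendsto_zero (tendsto_ofReal_pow hq hq1)
  have hinj : Function.Injective fun n : ℕ => q ^ n := pow_right_injective₀ hq hq1.ne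
  have hrange : Set.range (fun n : ℕ => ((q ^ n : ℝ) : ℂ)) =
      {z : ℂ | ∃ n : ℕ, z = ((q ^ n : ℝ) : ℂ)} := by
    ext z
    exact exists_congr fun n => eq_comm
  rcases hβ.eq_or_lt with rfl | hβ'
  · rw [spectrum_eq_closure_of_hasSum_sq (isSelfAdjoint_L hq α hβ)
      (fun f => eq_zero_of_L_eq_zero hq hq1 hα hβ) stdBasis (sum_norm_sq_L_le hq hq1 hα hβ)
      (eigVec_ne_zero hq hq1 hα hβ) hinj (L_eigVec hq hq1 hα hβ)
      (by simpa using hasSum_sq_pow hq hq1), hpow, hrange, Set.insert_eq]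
    congr 1
    ext z
    simp only [neg_zero, zero_mul, Complex.ofReal_zero, Set.mem_union, Set.mem_ofPred_eq,
      Set.mem_singleton_iff]
    exact ⟨Or.inr, fun h => h.elim (fun ⟨_, _, h⟩ => h) id⟩
  · let μ : ℕ ⊕ ℕ → ℝ := Sum.elim (fun n => q ^ n) fun n => -β * q ^ (n + 1)
    let v : ℕ ⊕ ℕ → L2Z := Sum.elim (eigVec hq hq1 hα hβ) (negEigVec hq hq1 hα hβ')
    have hv : ∀ i, v i ≠ 0 := by
      rintro (n | n)
      · exact eigVec_ne_zero hq hq1 hα hβ n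
      · exact negEigVec_ne_zero hq hq1 hα hβ' n
    have hμ : ∀ i, L hq α hβ (v i) = (μ i : ℂ) • v i := by
      rintro (n | n)
      · exact L_eigVec hq hq1 hα hβ n
      · exact L_negEigVec hq hq1 hα hβ' n
    have hμinj : Function.Injective μ := by
      refine hinj.sumElim (fun m n hmn => ?_) fun m n hmn => ?_
      · have : q ^ (m + 1) = q ^ (n + 1) := mul_left_cancel₀ (neg_ne_zero.2 hβ'.ne') hmn
        have := hinj this
        lia
      · have h1 : 0 < q ^ m := by positivity
        have h2 : 0 < β * q ^ (n + 1) := by positivity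
        have h3 : q ^ m = -β * q ^ (n + 1) := hmn
        linarith
    have hneg : HasSum (fun n : ℕ => (-β * q ^ (n + 1)) ^ 2) (β ^ 2 * q ^ 2 / (1 - q ^ 2)) := by
      have := (hasSum_sq_pow hq hq1).mul_left (β ^ 2 * q ^ 2)
      rw [mul_one_div] at this
      refine this.congr_fun ?_
      intro n
      ring
    have hsum : HasSum (fun i => μ i ^ 2) ((1 + β ^ 2 * q ^ 2) / (1 - q ^ 2)) := by
      rw [add_div]
      exact HasSum.sum (f := fun i => μ i ^ 2) (hasSum_sq_pow hq hq1) hneg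
    have hlim : Tendsto (fun n : ℕ => ((-β * q ^ (n + 1) : ℝ) : ℂ)) atTop (𝓝 0) := by
      have := ((tendsto_ofReal_pow hq hq1).comp (tendsto_add_atTop_nat 1)).const_mul (-β : ℂ)
      simpa using this
    have hclneg := closure_range_of_tendsto_zero hlim
    have hrangeneg : Set.range (fun n : ℕ => ((-β * q ^ (n + 1) : ℝ) : ℂ)) =
        {z : ℂ | ∃ n : ℕ, 1 ≤ n ∧ z = ((-β * q ^ n : ℝ) : ℂ)} := by
      ext z
      constructor
      · rintro ⟨n, rfl⟩
        exact ⟨n + 1, by lia, rfl⟩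
      · rintro ⟨n, hn, rfl⟩
        exact ⟨n - 1, by simp only [Nat.sub_add_cancel hn]⟩
    have hμrange : (Set.range fun i => (μ i : ℂ)) =
        Set.range (fun n : ℕ => ((q ^ n : ℝ) : ℂ)) ∪
          Set.range (fun n : ℕ => ((-β * q ^ (n + 1) : ℝ) : ℂ)) := by
      rw [← Set.Sum.elim_range]
      congr 1
      ext (n | n) <;> rfl
    rw [spectrum_eq_closure_of_hasSum_sq (isSelfAdjoint_L hq α hβ)
      (fun f => eq_zero_of_L_eq_zero hq hq1 hα hβ) stdBasis (sum_norm_sq_L_le hq hq1 hα hβ)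
      hv hμinj hμ hsum, hμrange, closure_union, hpow, hclneg, hrange, hrangeneg]
    ext z
    simp only [Set.mem_union, Set.mem_insert_iff, Set.mem_singleton_iff]
    tauto

end SymASC

end

theorem mainTheorem2 (q α β : ℝ) (hq : 0 < q) (hq1 : q < 1) (hα : α ≠ 0) (hβ : 0 ≤ β) :
    -- `L(α, β)` is self-adjoint, with the stated spectrum
    IsSelfAdjoint (SymASC.L hq α hβ) ∧
    spectrum ℂ (SymASC.L hq α hβ) =
      {z : ℂ | ∃ n : ℕ, 1 ≤ n ∧ z = ((-β * q ^ n : ℝ) : ℂ)} ∪ {0} ∪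
        {z : ℂ | ∃ n : ℕ, z = ((q ^ n : ℝ) : ℂ)} ∧
    -- `0` is an accumulation point of the spectrum and not an eigenvalue
    AccPt (0 : ℂ) (Filter.principal (spectrum ℂ (SymASC.L hq α hβ))) ∧
    ¬ Module.End.HasEigenvalue (SymASC.L hq α hβ : SymASC.L2Z →ₗ[ℂ] SymASC.L2Z) 0 ∧
    -- every `q ^ n` is a simple eigenvalue, with the stated eigenvector
    ∀ n : ℕ, ∃ v : SymASC.L2Z,
      (∀ l : ℤ, v l = ((SymASC.weight q α β l *
        (SymASC.h q β n).eval (SymASC.gridPoint q α l) : ℝ) : ℂ)) ∧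
      v ≠ 0 ∧
      Module.End.eigenspace (SymASC.L hq α hβ : SymASC.L2Z →ₗ[ℂ] SymASC.L2Z)
        ((q ^ n : ℝ) : ℂ) = Submodule.span ℂ {v} := by
  have hspec := SymASC.spectrum_L hq hq1 hα hβ
  refine ⟨SymASC.isSelfAdjoint_L hq α hβ, hspec, ?_, ?_, fun n => ?_⟩
  · rw [accPt_iff_frequently]
    refine (SymASC.tendsto_ofReal_pow hq hq1).frequently (Filter.Frequently.of_forall fun n => ?_)
    refine ⟨?_, ?_⟩
    · exact_mod_cast (pow_pos hq n).ne'
    · rw [hspec]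
      exact Or.inr ⟨n, rfl⟩
  · intro h0
    obtain ⟨f, hf⟩ := h0.exists_hasEigenvector
    refine hf.2 (SymASC.eq_zero_of_L_eq_zero hq hq1 hα hβ ?_)
    simpa using hf.apply_eq_smul
  · refine ⟨SymASC.eigVec hq hq1 hα hβ n, fun l => rfl, SymASC.eigVec_ne_zero hq hq1 hα hβ n, ?_⟩
    ext f
    rw [Module.End.mem_eigenspace_iff, Submodule.mem_span_singleton]
    constructor
    · intro hf
      obtain ⟨c, hc⟩ := SymASC.exists_eq_smul_of_eigenvector hq hq1 hα hβ hf
        (SymASC.L_eigVec hq hq1 hα hβ n) (SymASC.eigVec_ne_zero hq hq1 hα hβ n)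
      exact ⟨c, hc.symm⟩
    · rintro ⟨c, rfl⟩
      have := SymASC.L_eigVec hq hq1 hα hβ n
      rw [map_smul, smul_comm]
      exact congrArg (c • ·) this
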